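/- **Theorem 4.1.** *Model.* A local computation algorithm for a search problem on graphs is a randomized algorithm on a word RAM with words of $\Theta(\log n)$ bits. In one step it performs an arithmetic operation or comparison on words held in a constant number of registers, or accesses one word of the input (the degree or the $i$-th neighbour of a vertex of a graph on the vertices $0,\dots,n-1$ given by adjacency lists), of a tape of independent uniformly random words, or of its local memory. It knows $n$ and the maximum degree $d$. It receives a sequence of queries (vertices), answers each before the next one, and keeps its memory (initially zero) between queries. It is a $(t,s,\delta)$-*local computation algorithm* if, for all contents of the random tape and all query sequences, each query is answered within $t$ steps using a local memory of at most $s$ words, and if, for every query sequence, with probability at least $1-\delta$ all answers agree with a single valid solution. *Statement.* There are a single algorithm $\mathcal A$ and absolute constants $c_1,c_2,c_3$ such that, for every $n\ge 2$ and every undirected graph $G$ with $n$ vertices and maximum degree $d$ (where $d^{c_2 d\log_2 d}:=1$ for $d=0$), $\mathcal A$ is a $$\bigl(c_1\, d^{\,c_2 d\log_2 d}\cdot\log_2 n,\; c_3\, n,\; 1/n\bigr)\text{-local computation algorithm}$$ on $G$ which, for a queried vertex $v$, decides whether $v$ is in a maximal independent set (the valid solutions are the indicator vectors of the maximal independent sets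 of $G$). Moreover, with probability at least $1-1/n$ over the random tape, there is one maximal independent set $I$ of $G$, not depending on the queries, such that in every sequence of queries every answer correctly says whether the queried vertex belongs to $I$. -/

import Mathlib

namespace LCA

/-! ### A word RAM with random-access input, random tape and memory

All quantities are natural numbers below `2 ^ w` (words of `w` bits).  A program has a fixed finite
number of registers, and every elementary instruction costs one step. -/

/-- Arithmetic on words and comparisons (`1` for true and `0` for false). -/
inductive BinOp
  | add | sub | mul | div | mod | lt | eq

/-- The result of an operation; subtraction is truncated at `0`, division by `0` gives `0`. -/
def BinOp.eval : BinOp → ℕ → ℕ → ℕ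
  | .add, a, b => a + b
  | .sub, a, b => a - b
  | .mul, a, b => a * b
  | .div, a, b => a / b
  | .mod, a, b => a % b
  | .lt, a, b => if a < b then 1 else 0
  | .eq, a, b => if a = b then 1 else 0

/-- Programs of the word RAM.  Natural numbers `x y z a b` are names of registers. -/
inductive Program
  /-- `x := c` -/
  | const (x : ℕ) (c : ℕ)
  /-- `x := y ∘ z` for an operation `∘` on words -/
  | op (f : BinOp) (x y z : ℕ)
  /-- `x := memory[a]` -/
  | load (x a : ℕ)
  /-- `memory[a] := x` -/
  | store (a x : ℕ)
  /-- `x := randomTape[a]` -/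
  | rand (x a : ℕ)
  /-- `x :=` the length of the adjacency list of vertex `a` -/
  | deg (x a : ℕ)
  /-- `x :=` entry number `b` (counted from `0`) of the adjacency list of vertex `a` -/
  | nbr (x a b : ℕ)
  /-- sequential composition -/
  | seq (p q : Program)
  /-- `if x ≠ 0 then p else q` -/
  | ite (x : ℕ) (p q : Program)
  /-- `while x ≠ 0 do p` -/
  | while (x : ℕ) (p : Program)

/-- The contents of the registers and of the local computation memory. -/
structure State where
  reg : ℕ → ℕ
  mem : ℕ → ℕ

/-- Assign the value `a` to the register `x`. -/
def State.set (σ : State) (x a : ℕ) : State := ⟨Function.update σ.reg x a, σ.mem⟩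

/-- A random tape: one word at each address that fits in a word. -/
abbrev Tape (w : ℕ) := Fin (2 ^ w) → Fin (2 ^ w)

/-- The word of the random tape at address `a`. -/
def Tape.read {w : ℕ} (ω : Tape w) (a : ℕ) : ℕ :=
  (ω ⟨a % 2 ^ w, Nat.mod_lt _ (by positivity)⟩ : ℕ)

/-- The adjacency lists (in any order) of a graph with vertices `0, …, n - 1`. -/
structure AdjacencyLists {n : ℕ} (G : SimpleGraph (Fin n)) where
  nbrs : Fin n → List (Fin n)
  nodup : ∀ v, (nbrs v).Nodup
  mem_nbrs : ∀ v u, u ∈ nbrs v ↔ G.Adj v u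

/-- The length of the adjacency list of vertex `a` (`0` if there is no such vertex). -/
def AdjacencyLists.degAt {n : ℕ} {G : SimpleGraph (Fin n)} (L : AdjacencyLists G) (a : ℕ) : ℕ :=
  if h : a < n then (L.nbrs ⟨a, h⟩).length else 0

/-- Entry `i` of the adjacency list of vertex `a` (`0` if there is no such entry). -/
def AdjacencyLists.nbrAt {n : ℕ} {G : SimpleGraph (Fin n)} (L : AdjacencyLists G) (a i : ℕ) : ℕ :=
  if h : a < n then ((L.nbrs ⟨a, h⟩).map Fin.val).getD i 0 else 0

section

variable {n : ℕ} {G : SimpleGraph (Fin n)}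

/-- `Exec L w s ω p σ t τ`: on the input graph given by the adjacency lists `L`, with words of `w`
bits, a memory of `s` words and the random tape `ω`, the program `p` started in state `σ` halts
after exactly `t` steps in state `τ`.  There is no execution that touches a memory address outside
`0, …, s - 1`. -/
inductive Exec (L : AdjacencyLists G) (w s : ℕ) (ω : Tape w) :
    Program → State → ℕ → State → Prop
  | const (x c : ℕ) (σ : State) :
      Exec L w s ω (.const x c) σ 1 (σ.set x (c % 2 ^ w))
  | op (f : BinOp) (x y z : ℕ) (σ : State) :
      Exec L w s ω (.op f x y z) σ 1 (σ.set x (f.eval (σ.reg y) (σ.reg z) % 2 ^ w))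
  | load (x a : ℕ) (σ : State) (h : σ.reg a < s) :
      Exec L w s ω (.load x a) σ 1 (σ.set x (σ.mem (σ.reg a)))
  | store (a x : ℕ) (σ : State) (h : σ.reg a < s) :
      Exec L w s ω (.store a x) σ 1 ⟨σ.reg, Function.update σ.mem (σ.reg a) (σ.reg x)⟩
  | rand (x a : ℕ) (σ : State) :
      Exec L w s ω (.rand x a) σ 1 (σ.set x (ω.read (σ.reg a)))
  | deg (x a : ℕ) (σ : State) :
      Exec L w s ω (.deg x a) σ 1 (σ.set x (L.degAt (σ.reg a)))
  | nbr (x a b : ℕ) (σ : State) :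
      Exec L w s ω (.nbr x a b) σ 1 (σ.set x (L.nbrAt (σ.reg a) (σ.reg b)))
  | seq (p q : Program) (σ τ υ : State) (t₁ t₂ : ℕ) (h₁ : Exec L w s ω p σ t₁ τ)
      (h₂ : Exec L w s ω q τ t₂ υ) : Exec L w s ω (.seq p q) σ (t₁ + t₂) υ
  | ite_true (x : ℕ) (p q : Program) (σ τ : State) (t : ℕ) (hx : σ.reg x ≠ 0)
      (h : Exec L w s ω p σ t τ) : Exec L w s ω (.ite x p q) σ (t + 1) τ
  | ite_false (x : ℕ) (p q : Program) (σ τ : State) (t : ℕ) (hx : σ.reg x = 0)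
      (h : Exec L w s ω q σ t τ) : Exec L w s ω (.ite x p q) σ (t + 1) τ
  | while_done (x : ℕ) (p : Program) (σ : State) (hx : σ.reg x = 0) :
      Exec L w s ω (.while x p) σ 1 σ
  | while_step (x : ℕ) (p : Program) (σ τ υ : State) (t₁ t₂ : ℕ) (hx : σ.reg x ≠ 0)
      (h₁ : Exec L w s ω p σ t₁ τ) (h₂ : Exec L w s ω (.while x p) τ t₂ υ) :
      Exec L w s ω (.while x p) σ (t₁ + t₂ + 1) υ

/-- For a fixed random tape the machine is deterministic. -/
theorem Exec.deterministic {L : AdjacencyLists G} {w s : ℕ} {ω : Tape w} {p : Program}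
    {σ τ τ' : State} {t t' : ℕ} (h : Exec L w s ω p σ t τ) (h' : Exec L w s ω p σ t' τ') :
    t = t' ∧ τ = τ' := by
  induction h generalizing t' τ' with
  | const | op | load | store | rand | deg | nbr => cases h'; exact ⟨rfl, rfl⟩
  | seq p q σ τ υ t₁ t₂ h₁ h₂ ih₁ ih₂ =>
    cases h' with
    | seq _ _ _ _ _ _ _ k₁ k₂ =>
      obtain ⟨rfl, rfl⟩ := ih₁ k₁
      obtain ⟨rfl, rfl⟩ := ih₂ k₂
      exact ⟨rfl, rfl⟩
  | ite_true x p q σ τ t hx h ih =>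
    cases h' with
    | ite_true _ _ _ _ _ _ _ k => obtain ⟨rfl, rfl⟩ := ih k; exact ⟨rfl, rfl⟩
    | ite_false _ _ _ _ _ _ hx' _ => exact absurd hx' hx
  | ite_false x p q σ τ t hx h ih =>
    cases h' with
    | ite_true _ _ _ _ _ _ hx' _ => exact absurd hx hx'
    | ite_false _ _ _ _ _ _ _ k => obtain ⟨rfl, rfl⟩ := ih k; exact ⟨rfl, rfl⟩
  | while_done x p σ hx =>
    cases h' with
    | while_done => exact ⟨rfl, rfl⟩
    | while_step _ _ _ _ _ _ _ hx' _ _ => exact absurd hx hx'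
  | while_step x p σ τ υ t₁ t₂ hx h₁ h₂ ih₁ ih₂ =>
    cases h' with
    | while_done _ _ _ hx' => exact absurd hx' hx
    | while_step _ _ _ _ _ _ _ _ k₁ k₂ =>
      obtain ⟨rfl, rfl⟩ := ih₁ k₁
      obtain ⟨rfl, rfl⟩ := ih₂ k₂
      exact ⟨rfl, rfl⟩

/-! ### Local computation algorithms -/

/-- A randomized algorithm: one program for all inputs, together with the constant that fixes
the word length. -/
structure Algorithm where
  program : Program
  wordFactor : ℕ

/-- Words have `Θ(log n)` bits on graphs with `n` vertices; `Nat.size n = ⌊log₂ n⌋ + 1`. -/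
def Algorithm.wordLength (A : Algorithm) (n : ℕ) : ℕ := (A.wordFactor + 1) * Nat.size n

/-- The registers at the start of a query: the number `n` of vertices, the maximum degree `d`, the
queried vertex `v`, and `0` in all other registers. -/
def initialRegisters (n d v : ℕ) : ℕ → ℕ
  | 0 => n
  | 1 => d
  | 2 => v
  | _ => 0

/-- `Answers A d L t s ω m qs as`: with the memory contents `m` before the first query, the
algorithm answers the queries `qs` one after the other by the words `as` (found in register `0`),
with at most `t` steps for each query.  The memory is kept from one query to the next. -/
def Answers (A : Algorithm) (d : ℕ) (L : AdjacencyLists G) (t : ℝ) (s : ℕ)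
    (ω : Tape (A.wordLength n)) : (ℕ → ℕ) → List (Fin n) → List ℕ → Prop
  | _, [], [] => True
  | m, v :: qs, a :: as => ∃ (k : ℕ) (τ : State), (k : ℝ) ≤ t ∧
      Exec L (A.wordLength n) s ω A.program ⟨initialRegisters n d v, m⟩ k τ ∧
      τ.reg 0 = a ∧ Answers A d L t s ω τ.mem qs as
  | _, _, _ => False

/-- The probability of an event under a uniformly random element of a finite type. -/
noncomputable def prob {Ω : Type} [Fintype Ω] (E : Set Ω) : ℝ := E.ncard / Fintype.card Ω

/-- `A` is a `(t, s, δ)`-local computation algorithm on the input graph given by `L`, of maximum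
degree `d`, for the search problem whose set of valid solutions is `F`.  The memory has `s` words,
all `0` at the beginning. -/
structure IsLocalComputationAlgorithm (A : Algorithm) (d : ℕ) (L : AdjacencyLists G)
    (F : Set (Fin n → ℕ)) (t : ℝ) (s : ℕ) (δ : ℝ) : Prop where
  /-- Whatever the random words and the earlier queries are, each query is answered within time `t`
  and space `s`. -/
  resources : ∀ (ω : Tape (A.wordLength n)) (qs : List (Fin n)),
    ∃ as, Answers A d L t s ω 0 qs as
  /-- For every sequence of queries, the probability that all answers agree with one valid solution
  is at least `1 - δ`. -/
  success : ∀ qs : List (Fin n),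
    1 - δ ≤ prob {ω : Tape (A.wordLength n) | ∃ y ∈ F, Answers A d L t s ω 0 qs (qs.map y)}

/-- The indicator vectors of the maximal independent sets of `G`. -/
def misSolutions (G : SimpleGraph (Fin n)) : Set (Fin n → ℕ) :=
  {y | ∃ I : Set (Fin n), Maximal (fun J : Set (Fin n) => G.IsIndepSet J) I ∧
    ∀ v, (v ∈ I → y v = 1) ∧ (v ∉ I → y v = 0)}

end

end LCA

/-!
Every vertex `u` draws a level in `{0, …, l - 1}`, `l = 64 (d + 1)`, from its own random word, and
the answer to every query is membership in the maximal independent set that the greedy algorithm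
builds in the order of increasing levels, ties broken by the names of the vertices. This set is a
function of the random tape alone, so consistency is automatic, and the only thing that can go wrong
is that a query takes too long.

*Small cones.* The decision about `v` depends only on the vertices that are reachable from `v` along
paths of decreasing keys. Let `S i` (`levelCone`) be the set of vertices reachable from `v` along
paths with non-increasing levels, all at least `i`. Then `S l = {v}`, the set `S 0` contains the cone
of `v`, and the vertices of `S i` outside `S (i + 1)` have level exactly `i`. If `#(S i)` is at least
`m = 10 * Nat.size n` and at least `l * #(S (i + 1))`, then `S i` is a connected set through `v`
of which all but a fraction `1 / l` lies in one level (`NoDenseCluster` fails). A given set of `j`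
vertices lies in level `i` with probability at most `(2 / l) ^ j` (`prob_level_eq_le`), so a union
bound works once the connected sets through `v` are counted: with weight `(1 / (4 (d + 1))) ^ #A`
they sum to at most `1`, because for site percolation with parameter `1 / (d + 1)` the events that
the cluster of `v` equals `A` are disjoint (`sum_isRootedCluster_pow_le_one`). Hence with probability
at least `1 - 1 / n` no such set exists for any `v` and `i`, and then every cone has at most
`m * l ^ l` vertices (`prob_forall_noDenseCluster`, `ncard_greedyCone_le`).

*The machine.* A query runs a depth-first search with an explicit stack and a memo table, which is
kept between queries: every entry it ever contains is correct. Each iteration scans one adjacency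
list, and either decides the vertex on top of the stack or pushes an undecided neighbour of smaller
key, so at most twice as many iterations are needed as the cone has vertices (`SearchInv`). The
search stops after `20 * Nat.size n * l ^ l` iterations at the latest, which bounds the running time
for every tape (`runs_misProgram`). The memory consists of `n` words for the memo table and `n` words
for the stack.
-/

namespace LCA

/-! ### The greedy maximal independent set -/

section Greedy

variable {V : Type*} (G : SimpleGraph V) (key : V → ℕ)

/-- Membership in the independent set built by the greedy algorithm that scans the vertices in the
order of increasing `key`. -/
def GreedyMem (u : V) : Prop :=
  ∀ w, G.Adj u w → ∀ _ : key w < key u, ¬ GreedyMem w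
termination_by key u

variable {G key}

theorem greedyMem_iff {u : V} :
    GreedyMem G key u ↔ ∀ w, G.Adj u w → key w < key u → ¬ GreedyMem G key w := by
  rw [GreedyMem]

theorem maximal_greedyMem (hkey : Function.Injective key) :
    Maximal (fun J : Set V => G.IsIndepSet J) {u | GreedyMem G key u} := by
  refine ⟨?_, ?_⟩
  · intro a ha b hb hab hadj
    rcases lt_trichotomy (key a) (key b) with h | h | h
    · exact greedyMem_iff.1 hb a hadj.symm h ha
    · exact hab (hkey h)
    · exact greedyMem_iff.1 ha b hadj h hb
  · intro J hJ hle u hu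
    refine greedyMem_iff.2 fun w hadj _ hw => ?_
    exact hJ hu (hle hw) hadj.ne hadj

variable (G key)

/-- The vertices that the decision about `v` can depend on: those reachable from `v` along paths
of decreasing `key`. -/
def greedyCone (v : V) : Set V :=
  {u | Relation.ReflTransGen (fun a b => G.Adj a b ∧ key b < key a) v u}

end Greedy

/-! ### Counting connected sets through a vertex -/

section Clusters

variable {V : Type*} {G : SimpleGraph V}

/-- `A` contains `v` and induces a connected subgraph; connectedness is expressed by saying that
no proper part of `A` that contains `v` is closed under adjacency in `A`. -/
def IsRootedCluster (G : SimpleGraph V) (v : V) (A : Finset V) : Prop :=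
  v ∈ A ∧ ∀ C : Set V, v ∈ C → (∀ a ∈ C, ∀ b ∈ A, G.Adj a b → b ∈ C) → (A : Set V) ⊆ C

variable [Fintype V] [DecidableEq V]

open Classical in
/-- The vertices outside `A` with a neighbour in `A`. -/
noncomputable def outerBoundary (G : SimpleGraph V) (A : Finset V) : Finset V :=
  Finset.univ.filter fun b => b ∉ A ∧ ∃ a ∈ A, G.Adj a b

theorem IsRootedCluster.subset {v : V} {A A' D D' : Finset V} (hA : v ∈ A)
    (hA' : IsRootedCluster G v A') (hD : D ⊆ (A ∪ outerBoundary G A)ᶜ)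
    (h : A ∪ D = A' ∪ D') : A' ⊆ A := by
  have := hA'.2 A hA (fun a ha b hb hadj => ?_)
  · exact_mod_cast this
  · by_contra hbA
    have hb' : b ∈ A ∪ D := h ▸ Finset.mem_union_left _ hb
    rcases Finset.mem_union.1 hb' with h1 | h1
    · exact hbA h1
    · have := hD h1
      simp only [Finset.mem_compl, Finset.mem_union, not_or] at this
      exact this.2 (by simp only [outerBoundary, Finset.mem_filter, Finset.mem_univ, true_and]
                       exact ⟨hbA, a, ha, hadj⟩)

open Classical in
/-- In site percolation with parameter `x`, the clusters of `v` are the rooted clusters, and `A` is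
the cluster of `v` with probability `x ^ #A * (1 - x) ^ #(outerBoundary G A)`. -/
theorem sum_isRootedCluster_le_one (v : V) {x : ℝ} (hx0 : 0 ≤ x) (hx1 : x ≤ 1) :
    ∑ A : Finset V with IsRootedCluster G v A,
      x ^ A.card * (1 - x) ^ (outerBoundary G A).card ≤ 1 := by
  set f : Finset V → ℝ := fun B => x ^ B.card * (1 - x) ^ (Fintype.card V - B.card) with hf
  have hf0 : ∀ B, 0 ≤ f B := fun B =>
    mul_nonneg (pow_nonneg hx0 _) (pow_nonneg (sub_nonneg.2 hx1) _)
  have htot : ∑ B : Finset V, f B = 1 := by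
    have := Finset.sum_pow_mul_eq_add_pow x (1 - x) (Finset.univ : Finset V)
    simpa [hf] using this
  have hexp : ∀ A : Finset V, x ^ A.card * (1 - x) ^ (outerBoundary G A).card
      = ∑ D ∈ ((A ∪ outerBoundary G A)ᶜ).powerset, f (A ∪ D) := by
    intro A
    set R := (A ∪ outerBoundary G A)ᶜ with hR
    have hdisj : Disjoint A (outerBoundary G A) := by
      rw [Finset.disjoint_left]
      intro a ha hb
      simp only [outerBoundary, Finset.mem_filter] at hb
      exact hb.2.1 ha
    have hcard : A.card + (outerBoundary G A).card + R.card = Fintype.card V := by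
      rw [← Finset.card_union_of_disjoint hdisj, hR, Finset.card_add_card_compl]
    have h1 := Finset.sum_pow_mul_eq_add_pow x (1 - x) R
    have h2 : ∀ D ∈ R.powerset, f (A ∪ D) = x ^ A.card * (1 - x) ^ (outerBoundary G A).card *
        (x ^ D.card * (1 - x) ^ (R.card - D.card)) := by
      intro D hD
      have hD := Finset.mem_powerset.1 hD
      have hAD : Disjoint A D := by
        rw [Finset.disjoint_left]
        intro a ha hb
        have := hD hb
        rw [hR, Finset.mem_compl, Finset.mem_union] at this
        exact this (Or.inl ha)
      have hle := Finset.card_le_card hD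
      have : Fintype.card V - (A ∪ D).card
          = (outerBoundary G A).card + (R.card - D.card) := by
        rw [Finset.card_union_of_disjoint hAD]; omega
      simp only [hf]
      rw [this, Finset.card_union_of_disjoint hAD, pow_add, pow_add]
      ring
    rw [Finset.sum_congr rfl h2, ← Finset.mul_sum, h1]
    simp
  rw [Finset.sum_congr rfl fun A _ => hexp A, Finset.sum_sigma', ← htot]
  have hinj : Set.InjOn (fun p : (_ : Finset V) × Finset V => p.1 ∪ p.2)
      ((Finset.univ.filter fun A => IsRootedCluster G v A).sigma
        fun A => ((A ∪ outerBoundary G A)ᶜ).powerset) := by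
    rintro ⟨A, D⟩ h ⟨A', D'⟩ h' heq
    simp only [Finset.coe_sigma, Set.mem_sigma_iff, Finset.mem_coe, Finset.mem_filter,
      Finset.mem_univ, true_and, Finset.mem_powerset] at h h' heq
    obtain ⟨hA, hD⟩ := h
    obtain ⟨hA', hD'⟩ := h'
    have e : A = A' := (IsRootedCluster.subset hA'.1 hA hD' heq.symm).antisymm
      (IsRootedCluster.subset hA.1 hA' hD heq)
    subst e
    have key : ∀ D : Finset V, D ⊆ (A ∪ outerBoundary G A)ᶜ → D = (A ∪ D) \ A := by
      intro D hD
      ext a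
      have := @hD a
      simp only [Finset.mem_compl, Finset.mem_union, Finset.mem_sdiff] at this ⊢
      tauto
    have : D = D' := by rw [key D hD, key D' hD', heq]
    rw [this]
  rw [← Finset.sum_image (f := f) hinj]
  exact Finset.sum_le_sum_of_subset_of_nonneg (Finset.subset_univ _) fun B _ _ => hf0 B

open Classical in
theorem card_outerBoundary_le [DecidableRel G.Adj] (A : Finset V) :
    (outerBoundary G A).card ≤ A.card * G.maxDegree := by
  calc (outerBoundary G A).card ≤ (A.biUnion fun a => G.neighborFinset a).card := by
        refine Finset.card_le_card fun b hb => ?_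
        simp only [outerBoundary, Finset.mem_filter, Finset.mem_univ, true_and] at hb
        obtain ⟨_, a, ha, hadj⟩ := hb
        simp only [Finset.mem_biUnion, SimpleGraph.mem_neighborFinset]
        exact ⟨a, ha, hadj⟩
    _ ≤ A.card * G.maxDegree :=
        Finset.card_biUnion_le_card_mul _ _ _ fun a _ => G.degree_le_maxDegree a

theorem quarter_le_pow (d : ℕ) : (1 / 4 : ℝ) ≤ (1 - 1 / (d + 1 : ℝ)) ^ d := by
  rcases Nat.eq_zero_or_pos d with rfl | hd
  · norm_num
  have hd' : (0 : ℝ) < d := by exact_mod_cast hd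
  have h1 : (1 + 1 / (d : ℝ)) ^ d ≤ 4 := by
    calc (1 + 1 / (d : ℝ)) ^ d ≤ (Real.exp (1 / d)) ^ d := by
          gcongr
          rw [add_comm]
          exact Real.add_one_le_exp _
      _ = Real.exp 1 := by
          rw [← Real.exp_nat_mul]
          congr 1
          field_simp
      _ ≤ 4 := by linarith [Real.exp_one_lt_d9]
  have h2 : (1 - 1 / (d + 1 : ℝ)) ^ d = 1 / (1 + 1 / (d : ℝ)) ^ d := by
    rw [← one_div_pow]
    congr 1
    field_simp
    ring
  rw [h2]
  exact one_div_le_one_div_of_le (by positivity) h1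

open Classical in
/-- There are at most `(4 (d + 1)) ^ m` connected sets of size `m` through a given vertex, stated
through the generating function. -/
theorem sum_isRootedCluster_pow_le_one [DecidableRel G.Adj] (v : V) :
    ∑ A : Finset V with IsRootedCluster G v A,
      (1 / (4 * (G.maxDegree + 1 : ℝ))) ^ A.card ≤ 1 := by
  have hpos : (0 : ℝ) < G.maxDegree + 1 := by positivity
  have hx1 : 1 / (G.maxDegree + 1 : ℝ) ≤ 1 := by
    rw [div_le_one hpos]
    linarith [(Nat.cast_nonneg G.maxDegree : (0 : ℝ) ≤ _)]
  refine le_trans (Finset.sum_le_sum fun A _ => ?_)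
    (sum_isRootedCluster_le_one (G := G) v (x := 1 / (G.maxDegree + 1 : ℝ)) (by positivity) hx1)
  have h0 : 0 ≤ 1 - 1 / (G.maxDegree + 1 : ℝ) := sub_nonneg.2 hx1
  calc (1 / (4 * (G.maxDegree + 1 : ℝ))) ^ A.card
      = (1 / (G.maxDegree + 1 : ℝ)) ^ A.card * (1 / 4) ^ A.card := by
        rw [← mul_pow]; congr 1; field_simp
    _ ≤ (1 / (G.maxDegree + 1 : ℝ)) ^ A.card *
          ((1 - 1 / (G.maxDegree + 1 : ℝ)) ^ G.maxDegree) ^ A.card := by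
        gcongr
        exact quarter_le_pow _
    _ ≤ _ := by
        rw [← pow_mul, mul_comm G.maxDegree]
        gcongr ?_ * ?_
        exact pow_le_pow_of_le_one h0 (by linarith [one_div_pos.2 hpos]) (card_outerBoundary_le A)

end Clusters

/-! ### Cones of the greedy order by levels -/

section Levels

variable {V : Type*} [Fintype V] (G : SimpleGraph V) (lev : V → ℕ)

open Classical in
/-- The vertices reachable from `v` along paths of non-increasing levels, all at least `i` (with
no condition on the level of `v` from below). -/
noncomputable def levelCone (v : V) (i : ℕ) : Finset V :=
  Finset.univ.filter fun u =>
    Relation.ReflTransGen (fun a b => G.Adj a b ∧ lev b ≤ lev a ∧ i ≤ lev b) v u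

variable {G lev}

theorem mem_levelCone {v u : V} {i : ℕ} : u ∈ levelCone G lev v i ↔
    Relation.ReflTransGen (fun a b => G.Adj a b ∧ lev b ≤ lev a ∧ i ≤ lev b) v u := by
  simp [levelCone]

theorem isRootedCluster_levelCone (v : V) (i : ℕ) :
    IsRootedCluster G v (levelCone G lev v i) := by
  refine ⟨mem_levelCone.2 .refl, fun C hv hC u hu => ?_⟩
  replace hu := mem_levelCone.1 (Finset.mem_coe.1 hu)
  induction hu with
  | refl => exact hv
  | tail hab hbc ih => exact hC _ ih _ (mem_levelCone.2 (hab.tail hbc)) hbc.1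

theorem mem_levelCone_succ {v u : V} {i : ℕ} (hu : u ∈ levelCone G lev v i) (hi : i < lev u) :
    u ∈ levelCone G lev v (i + 1) := by
  replace hu := mem_levelCone.1 hu
  rw [mem_levelCone]
  induction hu with
  | refl => exact .refl
  | tail _ hbc ih => exact (ih (hi.trans_le hbc.2.1)).tail ⟨hbc.1, hbc.2.1, hi⟩

theorem levelCone_eq_singleton {v : V} {l : ℕ} (hlev : ∀ u, lev u < l) :
    levelCone G lev v l = {v} := by
  ext u
  rw [mem_levelCone, Finset.mem_singleton]
  refine ⟨fun h => ?_, fun h => h ▸ .refl⟩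
  induction h with
  | refl => rfl
  | tail _ hbc _ => exact absurd hbc.2.2 (hlev _).not_ge

/-- The levels `lev` have no connected set of at least `m` vertices through `v` that lies, up to a
fraction `1 / l`, in the level `i`. -/
def NoDenseCluster (G : SimpleGraph V) (lev : V → ℕ) (l m : ℕ) (v : V) (i : ℕ) : Prop :=
  ∀ A : Finset V, IsRootedCluster G v A → m ≤ A.card →
    (A.filter fun u => lev u = i).card + A.card / l < A.card

theorem card_levelCone_le {l m : ℕ} (hm : 1 ≤ m) (hlev : ∀ u, lev u < l) {v : V}
    (h : ∀ i < l, NoDenseCluster G lev l m v i) (j : ℕ) (hj : j ≤ l) :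
    (levelCone G lev v (l - j)).card ≤ m * l ^ j := by
  induction j with
  | zero => simpa [levelCone_eq_singleton hlev] using hm
  | succ j ih =>
    have ih := ih (by omega)
    have hl : 0 < l := by omega
    set i := l - (j + 1) with hi
    have hi' : l - j = i + 1 := by omega
    rw [hi'] at ih
    by_cases hbig : m ≤ (levelCone G lev v i).card
    · have h1 := h i (by omega) _ (isRootedCluster_levelCone v i) hbig
      have h2 : ((levelCone G lev v i).filter fun u => ¬ lev u = i).card
          ≤ (levelCone G lev v (i + 1)).card := by
        refine Finset.card_le_card fun u hu => ?_
        obtain ⟨hu, hne⟩ := Finset.mem_filter.1 hu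
        by_cases huv : u = v
        · exact huv ▸ mem_levelCone.2 .refl
        · have : i ≤ lev u := by
            rcases Relation.ReflTransGen.cases_tail (mem_levelCone.1 hu) with h | ⟨_, _, h⟩
            · exact absurd h huv
            · exact h.2.2
          exact mem_levelCone_succ hu (by omega)
      have h3 := Finset.card_filter_add_card_filter_not (s := levelCone G lev v i)
        (fun u => lev u = i)
      have h4 : (levelCone G lev v i).card / l < (levelCone G lev v (i + 1)).card := by omega
      rw [Nat.div_lt_iff_lt_mul hl] at h4
      calc (levelCone G lev v i).card ≤ (levelCone G lev v (i + 1)).card * l := h4.le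
        _ ≤ m * l ^ j * l := Nat.mul_le_mul_right _ ih
        _ = m * l ^ (j + 1) := by ring
    · calc (levelCone G lev v i).card ≤ m := by omega
        _ ≤ m * l ^ (j + 1) := Nat.le_mul_of_pos_right _ (by positivity)

theorem ncard_greedyCone_le {l m : ℕ} (hm : 1 ≤ m) (hlev : ∀ u, lev u < l) {v : V}
    (h : ∀ i < l, NoDenseCluster G lev l m v i) {key : V → ℕ}
    (hkey : ∀ a b, key b < key a → lev b ≤ lev a) :
    (greedyCone G key v).ncard ≤ m * l ^ l := by
  have := card_levelCone_le hm hlev h l le_rfl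
  rw [Nat.sub_self] at this
  refine le_trans ?_ this
  rw [← Set.ncard_coe_finset]
  refine Set.ncard_le_ncard (fun u hu => ?_) (Finset.finite_toSet _)
  rw [Finset.mem_coe, mem_levelCone]
  have hu : Relation.ReflTransGen (fun a b => G.Adj a b ∧ key b < key a) v u := hu
  exact Relation.ReflTransGen.mono
    (fun a b hab => ⟨hab.1, hkey a b hab.2, Nat.zero_le _⟩) v u hu

end Levels

/-! ### Probability of a dense cluster -/

section Probability

theorem prob_mono {Ω : Type} [Fintype Ω] {E F : Set Ω} (h : E ⊆ F) : prob E ≤ prob F := by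
  unfold prob
  gcongr
  exact Set.toFinite F

theorem prob_compl {Ω : Type} [Fintype Ω] [Nonempty Ω] (E : Set Ω) :
    prob Eᶜ = 1 - prob E := by
  have h : (0 : ℝ) < Fintype.card Ω := by exact_mod_cast Fintype.card_pos
  have := Set.ncard_add_ncard_compl E
  rw [Nat.card_eq_fintype_card] at this
  unfold prob
  rw [← this] at h ⊢
  push_cast at h ⊢
  field_simp
  ring

theorem prob_biUnion_le {Ω ι : Type} [Fintype Ω] (s : Finset ι) (E : ι → Set Ω) :
    prob (⋃ i ∈ s, E i) ≤ ∑ i ∈ s, prob (E i) := by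
  unfold prob
  rw [← Finset.sum_div]
  gcongr
  exact_mod_cast Finset.set_ncard_biUnion_le s E

/-- The level of a vertex: its random word reduced modulo the number `l` of levels. -/
def level {w : ℕ} (ω : Tape w) (l u : ℕ) : ℕ := ω.read u % l

theorem card_filter_mod_eq_le {N l : ℕ} (hl : 0 < l) (hlN : l ≤ N) (i : ℕ) :
    ((Finset.univ.filter fun x : Fin N => (x : ℕ) % l = i).card : ℝ) ≤ 2 / l * N := by
  have h1 : (Finset.univ.filter fun x : Fin N => (x : ℕ) % l = i).card
      ≤ (Finset.range (N / l + 1)).card := by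
    refine Finset.card_le_card_of_injOn (fun x => (x : ℕ) / l) (fun x _ => ?_) ?_
    · have := Nat.div_le_div_right (c := l) x.2.le
      simp only [Finset.coe_range, Set.mem_Iio]
      omega
    · intro x hx y hy hxy
      simp only [Finset.coe_filter, Finset.mem_univ, true_and, Set.mem_ofPred_eq] at hx hy
      refine Fin.ext ?_
      rw [← Nat.div_add_mod (x : ℕ) l, ← Nat.div_add_mod (y : ℕ) l, hx, hy]
      simp only at hxy
      rw [hxy]
  rw [Finset.card_range] at h1
  have h2 : (0 : ℝ) < l := by exact_mod_cast hl
  have h3 : ((N / l : ℕ) : ℝ) ≤ N / l := Nat.cast_div_le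
  have h4 : (1 : ℝ) ≤ N / l := by
    rw [le_div_iff₀ h2]; exact_mod_cast (by omega : 1 * l ≤ N)
  calc _ ≤ ((N / l + 1 : ℕ) : ℝ) := by exact_mod_cast h1
    _ ≤ 2 / l * N := by push_cast; rw [div_mul_eq_mul_div, mul_div_assoc]; linarith

theorem prob_level_eq_le {w n l : ℕ} (hn : n ≤ 2 ^ w) (hl : 0 < l) (hlw : l ≤ 2 ^ w) (i : ℕ)
    (B : Finset (Fin n)) :
    prob {ω : Tape w | ∀ u ∈ B, level ω l u = i} ≤ (2 / l : ℝ) ^ B.card := by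
  classical
  set e : Fin n ↪ Fin (2 ^ w) := Fin.castLEEmb hn with he
  have hset : {ω : Tape w | ∀ u ∈ B, level ω l u = i}
      = (Fintype.piFinset fun a : Fin (2 ^ w) => if a ∈ B.map e then
          Finset.univ.filter fun x : Fin (2 ^ w) => (x : ℕ) % l = i else Finset.univ) := by
    ext ω
    simp only [Set.mem_ofPred_eq, Finset.mem_coe, Fintype.mem_piFinset]
    have hread : ∀ u : Fin n, level ω l u = (ω (e u) : ℕ) % l := by
      intro u
      have hlt : (u : ℕ) % 2 ^ w = u := Nat.mod_eq_of_lt (u.2.trans_le hn)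
      simp only [level, Tape.read, he]
      congr 3
      exact Fin.ext hlt
    constructor
    · intro h a
      split_ifs with ha
      · obtain ⟨u, hu, rfl⟩ := Finset.mem_map.1 ha
        simpa [hread] using h u hu
      · exact Finset.mem_univ _
    · intro h u hu
      have := h (e u)
      rw [if_pos (Finset.mem_map_of_mem e hu)] at this
      rw [hread]
      exact (Finset.mem_filter.1 this).2
  have hN : (0 : ℝ) < ((2 ^ w : ℕ) : ℝ) := by positivity
  unfold prob
  rw [hset, Set.ncard_coe_finset, Fintype.card_piFinset, div_le_iff₀
    (by exact_mod_cast Fintype.card_pos)]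
  have hcard : (B.map e).card = B.card := Finset.card_map e
  calc ((∏ a : Fin (2 ^ w), (if a ∈ B.map e then
          Finset.univ.filter fun x : Fin (2 ^ w) => (x : ℕ) % l = i
          else Finset.univ).card : ℕ) : ℝ)
      ≤ ∏ a : Fin (2 ^ w), ((if a ∈ B.map e then (2 / l : ℝ) else 1) * ((2 ^ w : ℕ) : ℝ)) := by
        rw [Nat.cast_prod]
        refine Finset.prod_le_prod (fun _ _ => by positivity) fun a _ => ?_
        split_ifs
        · exact card_filter_mod_eq_le hl hlw i
        · simp
    _ = (2 / l : ℝ) ^ B.card * (Fintype.card (Tape w) : ℝ) := by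
        rw [Finset.prod_mul_distrib, Finset.prod_ite_mem]
        simp [div_pow]

theorem pow_sub_div_le {l : ℕ} (hl : 0 < l) (m : ℕ) :
    (2 / l : ℝ) ^ (m - m / l) ≤ (4 / l : ℝ) ^ m := by
  have hl' : (0 : ℝ) < l := by exact_mod_cast hl
  have h1 : (l / 2 : ℝ) ^ (m / l) ≤ 2 ^ m := by
    calc (l / 2 : ℝ) ^ (m / l) ≤ ((2 : ℝ) ^ l) ^ (m / l) := by
          gcongr
          have : (l : ℝ) ≤ 2 ^ l := by exact_mod_cast (Nat.lt_two_pow_self (n := l)).le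
          linarith
      _ = 2 ^ (l * (m / l)) := by rw [pow_mul]
      _ ≤ 2 ^ m := pow_le_pow_right₀ (by norm_num) (Nat.mul_div_le m l)
  have h2 : (2 / l : ℝ) ^ (m - m / l) = (2 / l : ℝ) ^ m * (l / 2 : ℝ) ^ (m / l) := by
    have h := pow_sub₀ (2 / l : ℝ) (by positivity) (Nat.div_le_self m l)
    rw [h, ← inv_pow, inv_div]
  calc (2 / l : ℝ) ^ (m - m / l) = (2 / l : ℝ) ^ m * (l / 2 : ℝ) ^ (m / l) := h2
    _ ≤ (2 / l : ℝ) ^ m * 2 ^ m := by gcongr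
    _ = (4 / l : ℝ) ^ m := by rw [← mul_pow]; congr 1; ring

variable {n : ℕ} {G : SimpleGraph (Fin n)} [DecidableRel G.Adj]

theorem prob_not_noDenseCluster_le {w l m : ℕ} (hl : l = 64 * (G.maxDegree + 1))
    (hn : n ≤ 2 ^ w) (hlw : l ≤ 2 ^ w) (v : Fin n) (i : ℕ) :
    prob {ω : Tape w | ¬ NoDenseCluster G (fun u => level ω l u) l m v i} ≤ (1 / 2) ^ m := by
  classical
  have hl0 : 0 < l := by omega
  have hlr : (l : ℝ) = 64 * (G.maxDegree + 1) := by rw [hl]; push_cast; ring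
  have hD : (0 : ℝ) < G.maxDegree + 1 := by positivity
  set F : Finset (Finset (Fin n)) :=
    Finset.univ.filter fun A => IsRootedCluster G v A ∧ m ≤ A.card with hF
  have hsub : {ω : Tape w | ¬ NoDenseCluster G (fun u => level ω l u) l m v i} ⊆
      ⋃ p ∈ F.sigma fun A => A.powersetCard (A.card - A.card / l),
        {ω : Tape w | ∀ u ∈ p.2, level ω l u = i} := by
    intro ω hω
    simp only [Set.mem_ofPred_eq, NoDenseCluster, not_forall, not_lt] at hω
    obtain ⟨A, hA, hm, hle⟩ := hω
    obtain ⟨B, hB, hBc⟩ := Finset.exists_subset_card_eq (tsub_le_iff_right.2 hle)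
    refine Set.mem_biUnion (x := (⟨A, B⟩ : (_ : Finset (Fin n)) × Finset (Fin n))) ?_ ?_
    · refine Finset.mem_coe.2 (Finset.mem_sigma.2 ⟨?_, ?_⟩)
      · exact Finset.mem_filter.2 ⟨Finset.mem_univ _, hA, hm⟩
      · exact Finset.mem_powersetCard.2 ⟨hB.trans (Finset.filter_subset _ _), hBc⟩
    · intro u hu
      exact (Finset.mem_filter.1 (hB hu)).2
  refine (prob_mono hsub).trans ((prob_biUnion_le _ _).trans ?_)
  rw [Finset.sum_sigma]
  have hA : ∀ A ∈ F, (∑ B ∈ A.powersetCard (A.card - A.card / l),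
      prob {ω : Tape w | ∀ u ∈ B, level ω l u = i})
      ≤ (1 / 2) ^ m * (1 / (4 * (G.maxDegree + 1 : ℝ))) ^ A.card := by
    intro A hA
    have hm := (Finset.mem_filter.1 hA).2.2
    calc _ ≤ ∑ B ∈ A.powersetCard (A.card - A.card / l), (4 / l : ℝ) ^ A.card := by
          refine Finset.sum_le_sum fun B hB => ?_
          refine (prob_level_eq_le hn hl0 hlw i B).trans ?_
          rw [(Finset.mem_powersetCard.1 hB).2]
          exact pow_sub_div_le hl0 _
      _ ≤ 2 ^ A.card * (4 / l : ℝ) ^ A.card := by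
          rw [Finset.sum_const, nsmul_eq_mul, Finset.card_powersetCard]
          gcongr
          exact_mod_cast Nat.choose_le_two_pow _ _
      _ = (1 / 2) ^ A.card * (1 / (4 * (G.maxDegree + 1 : ℝ))) ^ A.card := by
          rw [← mul_pow, ← mul_pow, hlr]
          congr 1
          field_simp
          norm_num
      _ ≤ _ := by
          gcongr ?_ * _
          exact pow_le_pow_of_le_one (by norm_num) (by norm_num) hm
  refine (Finset.sum_le_sum hA).trans ?_
  rw [← Finset.mul_sum]
  refine mul_le_of_le_one_right (by positivity) ?_
  refine le_trans (Finset.sum_le_sum_of_subset_of_nonneg ?_ fun _ _ _ => by positivity)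
    (sum_isRootedCluster_pow_le_one (G := G) v)
  intro A hA
  exact Finset.mem_filter.2 ⟨Finset.mem_univ _, (Finset.mem_filter.1 hA).2.1⟩

theorem prob_forall_noDenseCluster {w l : ℕ} (hn0 : 2 ≤ n) (hl : l = 64 * (G.maxDegree + 1))
    (hn : n ≤ 2 ^ w) (hlw : l ≤ 2 ^ w) :
    1 - 1 / (n : ℝ) ≤ prob {ω : Tape w | ∀ v : Fin n, ∀ i < l,
      NoDenseCluster G (fun u => level ω l u) l (10 * Nat.size n) v i} := by
  classical
  have hnr : (0 : ℝ) < n := by exact_mod_cast (by omega : 0 < n)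
  set E := {ω : Tape w | ∀ v : Fin n, ∀ i < l,
      NoDenseCluster G (fun u => level ω l u) l (10 * Nat.size n) v i} with hE
  have hsub : Eᶜ ⊆ ⋃ p ∈ (Finset.univ : Finset (Fin n)) ×ˢ Finset.range l,
      {ω : Tape w | ¬ NoDenseCluster G (fun u => level ω l u) l (10 * Nat.size n) p.1 p.2} := by
    intro ω hω
    simp only [hE, Set.mem_compl_iff, Set.mem_ofPred_eq, not_forall] at hω
    obtain ⟨v, i, hi, h⟩ := hω
    refine Set.mem_biUnion (x := (v, i)) ?_ h
    simp [hi]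
  have hbound : prob Eᶜ ≤ 1 / n := by
    refine (prob_mono hsub).trans ((prob_biUnion_le _ _).trans ?_)
    refine (Finset.sum_le_sum fun p _ => prob_not_noDenseCluster_le hl hn hlw p.1 p.2).trans ?_
    rw [Finset.sum_const, Finset.card_product, Finset.card_univ, Fintype.card_fin,
      Finset.card_range, nsmul_eq_mul, one_div_pow, mul_one_div,
      div_le_div_iff₀ (by positivity) hnr, one_mul]
    have hdeg : G.maxDegree + 1 ≤ n := by
      have : Nonempty (Fin n) := ⟨⟨0, by omega⟩⟩
      simpa using G.maxDegree_lt_card_verts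
    have h1 : n < 2 ^ Nat.size n := Nat.lt_size_self n
    have h2 : 1 ≤ Nat.size n := Nat.size_pos.2 (by omega)
    have h3 : n * l * n ≤ 2 ^ (10 * Nat.size n) := by
      calc n * l * n ≤ 2 ^ Nat.size n * (2 ^ (6 * Nat.size n) * 2 ^ Nat.size n)
            * 2 ^ Nat.size n := by
            gcongr
            rw [hl]
            refine Nat.mul_le_mul ?_ (by omega)
            calc 64 = 2 ^ 6 := by norm_num
              _ ≤ 2 ^ (6 * Nat.size n) := Nat.pow_le_pow_right (by norm_num) (by omega)
        _ = 2 ^ (9 * Nat.size n) := by rw [← pow_add, ← pow_add, ← pow_add]; congr 1; ring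
        _ ≤ 2 ^ (10 * Nat.size n) := Nat.pow_le_pow_right (by norm_num) (by omega)
    exact_mod_cast h3
  have : Nonempty (Tape w) := ⟨fun a => a⟩
  rw [prob_compl] at hbound
  linarith

end Probability

/-! ### Reasoning about time-bounded executions -/

section Runs

variable {n : ℕ} {G : SimpleGraph (Fin n)}

theorem State.set_reg (σ : State) (x a y : ℕ) :
    (σ.set x a).reg y = if y = x then a else σ.reg y := by
  simp [State.set, Function.update_apply]

theorem State.set_mem (σ : State) (x a : ℕ) : (σ.set x a).mem = σ.mem := rfl

/-- The program halts within `T` steps in a state that satisfies `Q`. -/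
def Runs (L : AdjacencyLists G) (w s : ℕ) (ω : Tape w) (p : Program) (σ : State) (T : ℕ)
    (Q : State → Prop) : Prop :=
  ∃ t ≤ T, ∃ τ, Exec L w s ω p σ t τ ∧ Q τ

/-- A list of programs, run one after the other. Register `21` is written by the empty list, which
serves as the instruction without effect, and is used for nothing else. -/
def block : List Program → Program
  | [] => .const 21 0
  | p :: ps => .seq p (block ps)

variable {L : AdjacencyLists G} {w s : ℕ} {ω : Tape w} {p : Program} {ps : List Program}
  {σ : State} {T T' : ℕ} {Q Q' : State → Prop} {f : BinOp} {x y z a b c : ℕ}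

theorem Runs.mono (h : Runs L w s ω p σ T Q) (hT : T ≤ T') (hQ : ∀ τ, Q τ → Q' τ) :
    Runs L w s ω p σ T' Q' := by
  obtain ⟨t, ht, τ, hτ, hq⟩ := h
  exact ⟨t, ht.trans hT, τ, hτ, hQ τ hq⟩

theorem Runs.nil (h : Q (σ.set 21 0)) : Runs L w s ω (block []) σ 1 Q :=
  ⟨1, le_rfl, _, .const 21 0 σ, by simpa using h⟩

theorem Runs.cons (h : Runs L w s ω p σ T fun τ => Runs L w s ω (block ps) τ T' Q) :
    Runs L w s ω (block (p :: ps)) σ (T + T') Q := by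
  obtain ⟨t, ht, τ, hτ, t', ht', υ, hυ, hq⟩ := h
  exact ⟨t + t', by omega, υ, .seq _ _ _ _ _ _ _ hτ hυ, hq⟩

theorem Runs.cons_of_exec {τ : State} (h : Exec L w s ω p σ 1 τ)
    (h' : Runs L w s ω (block ps) τ T Q) : Runs L w s ω (block (p :: ps)) σ (T + 1) Q := by
  rw [add_comm]
  exact .cons ⟨1, le_rfl, τ, h, h'⟩

theorem Runs.const (hc : c < 2 ^ w) (h : Runs L w s ω (block ps) (σ.set x c) T Q) :
    Runs L w s ω (block (.const x c :: ps)) σ (T + 1) Q :=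
  .cons_of_exec (.const x c σ) (by rwa [Nat.mod_eq_of_lt hc])

theorem Runs.op (a : ℕ) (ha : f.eval (σ.reg y) (σ.reg z) = a) (haw : a < 2 ^ w)
    (h : Runs L w s ω (block ps) (σ.set x a) T Q) :
    Runs L w s ω (block (.op f x y z :: ps)) σ (T + 1) Q :=
  .cons_of_exec (.op f x y z σ) (by rwa [ha, Nat.mod_eq_of_lt haw])

theorem Runs.load (b : ℕ) (hb : σ.reg a = b) (hs : b < s)
    (h : Runs L w s ω (block ps) (σ.set x (σ.mem b)) T Q) :
    Runs L w s ω (block (.load x a :: ps)) σ (T + 1) Q :=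
  .cons_of_exec (.load x a σ (hb ▸ hs)) (by rwa [hb])

theorem Runs.store (b c : ℕ) (hb : σ.reg a = b) (hc : σ.reg x = c) (hs : b < s)
    (h : Runs L w s ω (block ps) ⟨σ.reg, Function.update σ.mem b c⟩ T Q) :
    Runs L w s ω (block (.store a x :: ps)) σ (T + 1) Q :=
  .cons_of_exec (.store a x σ (hb ▸ hs)) (by rwa [hb, hc])

theorem Runs.rand (b : ℕ) (hb : σ.reg a = b)
    (h : Runs L w s ω (block ps) (σ.set x (ω.read b)) T Q) :
    Runs L w s ω (block (.rand x a :: ps)) σ (T + 1) Q :=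
  .cons_of_exec (.rand x a σ) (by rwa [hb])

theorem Runs.deg (b : ℕ) (hb : σ.reg a = b)
    (h : Runs L w s ω (block ps) (σ.set x (L.degAt b)) T Q) :
    Runs L w s ω (block (.deg x a :: ps)) σ (T + 1) Q :=
  .cons_of_exec (.deg x a σ) (by rwa [hb])

theorem Runs.nbr (c c' : ℕ) (hc : σ.reg a = c) (hc' : σ.reg b = c')
    (h : Runs L w s ω (block ps) (σ.set x (L.nbrAt c c')) T Q) :
    Runs L w s ω (block (.nbr x a b :: ps)) σ (T + 1) Q :=
  .cons_of_exec (.nbr x a b σ) (by rwa [hc, hc'])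

theorem Runs.ite {q : Program} (h : σ.reg x ≠ 0 → Runs L w s ω p σ T Q)
    (h' : σ.reg x = 0 → Runs L w s ω q σ T Q) : Runs L w s ω (.ite x p q) σ (T + 1) Q := by
  by_cases hx : σ.reg x = 0
  · obtain ⟨t, ht, τ, hτ, hq⟩ := h' hx
    exact ⟨t + 1, by omega, τ, .ite_false _ _ _ _ _ _ hx hτ, hq⟩
  · obtain ⟨t, ht, τ, hτ, hq⟩ := h hx
    exact ⟨t + 1, by omega, τ, .ite_true _ _ _ _ _ _ hx hτ, hq⟩

theorem Runs.while (Inv : ℕ → State → Prop)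
    (hstep : ∀ k σ, Inv k σ → σ.reg x ≠ 0 → ∃ k', k = k' + 1 ∧ Runs L w s ω p σ T (Inv k'))
    (k : ℕ) (h : Inv k σ) :
    Runs L w s ω (.while x p) σ (k * (T + 1) + 1) fun τ => τ.reg x = 0 ∧ ∃ k', Inv k' τ := by
  induction k generalizing σ with
  | zero =>
    by_cases hx : σ.reg x = 0
    · exact ⟨1, by omega, σ, .while_done _ _ _ hx, hx, 0, h⟩
    · obtain ⟨k', hk, _⟩ := hstep 0 σ h hx
      omega
  | succ k ih =>
    by_cases hx : σ.reg x = 0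
    · exact ⟨1, by omega, σ, .while_done _ _ _ hx, hx, _, h⟩
    · obtain ⟨k', hk, t, ht, τ, hτ, hq⟩ := hstep _ σ h hx
      obtain rfl : k = k' := by omega
      obtain ⟨t', ht', υ, hυ, hq'⟩ := ih hq
      refine ⟨t + t' + 1, ?_, υ, .while_step _ _ _ _ _ _ _ hx hτ hυ, hq'⟩
      rw [add_mul, one_mul]
      omega

end Runs

/-! ### Adjacency lists -/

section AdjacencyLists

variable {n : ℕ} {G : SimpleGraph (Fin n)} (L : AdjacencyLists G)

theorem AdjacencyLists.degAt_le [DecidableRel G.Adj] (u : ℕ) : L.degAt u ≤ G.maxDegree := by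
  unfold AdjacencyLists.degAt
  split_ifs with h
  · rw [← List.toFinset_card_of_nodup (L.nodup _)]
    refine le_trans (Finset.card_le_card fun a ha => ?_) (G.degree_le_maxDegree ⟨u, h⟩)
    rw [List.mem_toFinset, L.mem_nbrs] at ha
    exact (G.mem_neighborFinset _ _).2 ha
  · exact Nat.zero_le _

theorem AdjacencyLists.exists_nbrAt_eq {u : Fin n} {j : ℕ} (hj : j < L.degAt u) :
    ∃ x : Fin n, L.nbrAt u j = x ∧ G.Adj u x := by
  simp only [AdjacencyLists.degAt, u.2, dif_pos] at hj
  refine ⟨(L.nbrs u)[j], ?_, (L.mem_nbrs _ _).1 (List.getElem_mem _)⟩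
  simp only [AdjacencyLists.nbrAt, u.2, dif_pos]
  rw [List.getD_eq_getElem _ _ (by simpa using hj)]
  simp

theorem AdjacencyLists.exists_lt_degAt {u x : Fin n} (h : G.Adj u x) :
    ∃ j < L.degAt u, L.nbrAt u j = x := by
  obtain ⟨j, hj, hx⟩ := List.getElem_of_mem ((L.mem_nbrs u x).2 h)
  refine ⟨j, by simpa [AdjacencyLists.degAt] using hj, ?_⟩
  simp only [AdjacencyLists.nbrAt, u.2, dif_pos]
  rw [List.getD_eq_getElem _ _ (by simpa using hj)]
  simp [hx]

end AdjacencyLists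

/-! ### Depth-first evaluation of the greedy set with memoization -/

section Search

variable {n : ℕ} {G : SimpleGraph (Fin n)} {key : ℕ → ℕ}

/-- The memo table in the cells `0, …, n - 1` of the memory is correct: a cell holds `0` (unknown),
`1` (in the greedy set) or `2` (not in the greedy set). -/
def MemoCorrect (G : SimpleGraph (Fin n)) (key m : ℕ → ℕ) : Prop :=
  ∀ u : Fin n, m u = 0 ∨ m u = 1 ∧ GreedyMem G (fun u => key u) u ∨
    m u = 2 ∧ ¬ GreedyMem G (fun u => key u) u

/-- The vertices the answer for `v` may depend on that are still undecided in the memory `m`. -/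
def undecided (G : SimpleGraph (Fin n)) (key : ℕ → ℕ) (v : Fin n) (m : ℕ → ℕ) : Set (Fin n) :=
  {u | u ∈ greedyCone G (fun u : Fin n => key u) v ∧ m u = 0}

/-- The invariant of the depth-first search for the query `v`, started with the budget `b₀`. The
stack has height `h` and occupies the cells `n, …, n + h - 1` of the memory `m`; the remaining
budget is `k`. The bound on `undecided` holds because each iteration either pushes or decides a
vertex. -/
structure SearchInv (G : SimpleGraph (Fin n)) (key : ℕ → ℕ) (v : Fin n) (b₀ : ℕ) (m : ℕ → ℕ)
    (h k : ℕ) : Prop where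
  memo : MemoCorrect G key m
  entry : ∀ j < h, ∃ u : Fin n, m (n + j) = u ∧ u ∈ undecided G key v m
  decreasing : ∀ i j, i < j → j < h → key (m (n + j)) < key (m (n + i))
  bottom : 0 < h → m n = v
  done : h = 0 → m v ≠ 0
  budget : 2 * (greedyCone G (fun u : Fin n => key u) v).ncard ≤ b₀ →
    2 * (undecided G key v m).ncard ≤ k + h

variable {v : Fin n} {b₀ h k : ℕ} {m : ℕ → ℕ}

theorem SearchInv.height_le (H : SearchInv G key v b₀ m h k) :
    h ≤ (undecided G key v m).ncard := by
  have : Nonempty (Fin n) := ⟨v⟩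
  choose! f hf using H.entry
  have : (f '' (Finset.range h : Set ℕ)).ncard = h := by
    rw [Set.InjOn.ncard_image, Set.ncard_coe_finset, Finset.card_range]
    intro i hi j hj hij
    have hi : i < h := by simpa using hi
    have hj : j < h := by simpa using hj
    by_contra hne
    have e : m (n + i) = m (n + j) := by rw [(hf i hi).1, (hf j hj).1, hij]
    rcases Nat.lt_or_gt_of_ne hne with hlt | hlt
    · exact (H.decreasing i j hlt hj).ne (by rw [e])
    · exact (H.decreasing j i hlt hi).ne (by rw [e])
  calc h = (f '' (Finset.range h : Set ℕ)).ncard := this.symm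
    _ ≤ _ := by
      refine Set.ncard_le_ncard ?_ (Set.toFinite _)
      rintro _ ⟨j, hj, rfl⟩
      exact (hf j (by simpa using hj)).2

theorem SearchInv.height_le_card (H : SearchInv G key v b₀ m h k) : h ≤ n := by
  refine H.height_le.trans ?_
  simpa using Set.ncard_le_ncard (Set.subset_univ (undecided G key v m)) Set.finite_univ

theorem MemoCorrect.start (hm : MemoCorrect G key m) (v : Fin n) (b₀ : ℕ) :
    SearchInv G key v b₀ (Function.update m n v) (if m v = 0 then 1 else 0) b₀ := by
  have hne : ∀ u : Fin n, Function.update m n v u = m u := fun u =>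
    Function.update_of_ne u.2.ne _ _
  refine ⟨fun u => by rw [hne]; exact hm u, fun j hj => ?_, fun i j hij hj => ?_,
    fun _ => Function.update_self _ _ _, fun h => ?_, fun h => ?_⟩
  · split_ifs at hj with hv
    · obtain rfl : j = 0 := by omega
      exact ⟨v, Function.update_self _ _ _, .refl, by rw [hne]; exact hv⟩
    · omega
  · split_ifs at hj <;> omega
  · rw [hne]
    intro hv
    simp [hv] at h
  · have : (undecided G key v (Function.update m n v)).ncard
        ≤ (greedyCone G (fun u : Fin n => key u) v).ncard :=
      Set.ncard_le_ncard (fun u hu => hu.1) (Set.toFinite _)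
    omega

theorem SearchInv.pop (H : SearchInv G key v b₀ m (h + 1) (k + 1)) {u : Fin n}
    (hu : m (n + h) = u) {c : ℕ} (hc : c = 1 ∧ GreedyMem G (fun u => key u) u ∨
      c = 2 ∧ ¬ GreedyMem G (fun u => key u) u) :
    SearchInv G key v b₀ (Function.update m u c) h k := by
  have hc0 : c ≠ 0 := by omega
  have hstack : ∀ j, Function.update m u c (n + j) = m (n + j) := fun j =>
    Function.update_of_ne (by omega) _ _
  have hmemo : ∀ a : Fin n, a ≠ u → Function.update m u c a = m a := fun a ha =>
    Function.update_of_ne (fun h => ha (Fin.ext h)) _ _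
  have hself : Function.update m u c u = c := Function.update_self _ _ _
  obtain ⟨u', hu', hund⟩ := H.entry h (by omega)
  obtain rfl : u = u' := Fin.ext (hu.symm.trans hu')
  have hsub : undecided G key v (Function.update m u c) = undecided G key v m \ {u} := by
    ext a
    by_cases ha : a = u
    · subst ha
      simp [undecided, hc0]
    · simp [undecided, hmemo a ha, ha]
  refine ⟨fun a => ?_, fun j hj => ?_, fun i j hij hj => ?_, fun h0 => ?_, fun h0 => ?_,
    fun hb => ?_⟩
  · by_cases ha : a = u
    · subst ha
      rw [hself]
      exact Or.inr hc
    · rw [hmemo a ha]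
      exact H.memo a
  · obtain ⟨a, ha, hau⟩ := H.entry j (by omega)
    refine ⟨a, by rw [hstack, ha], ?_⟩
    rw [hsub]
    refine ⟨hau, fun h' => ?_⟩
    have := H.decreasing j h hj (by omega)
    rw [hu, ha, Set.mem_singleton_iff.1 h'] at this
    exact this.false
  · rw [hstack, hstack]
    exact H.decreasing i j hij (by omega)
  · have := H.bottom (by omega)
    rw [← this]
    exact hstack 0
  · have := H.bottom (by omega)
    subst h0
    have e : v = u := Fin.ext (this.symm.trans hu)
    rw [e, hself]
    exact hc0
  · have h1 := H.budget hb
    have h2 := Set.ncard_sdiff_singleton_add_one hund (Set.toFinite _)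
    rw [hsub]
    omega

theorem SearchInv.push (H : SearchInv G key v b₀ m (h + 1) (k + 1)) {u x : Fin n}
    (hu : m (n + h) = u) (hadj : G.Adj u x) (hkey : key x < key u) (hx : m x = 0) :
    SearchInv G key v b₀ (Function.update m (n + (h + 1)) x) (h + 2) k := by
  obtain ⟨u', hu', hund⟩ := H.entry h (by omega)
  obtain rfl : u = u' := Fin.ext (hu.symm.trans hu')
  have hstack : ∀ j < h + 1, Function.update m (n + (h + 1)) x (n + j) = m (n + j) := fun j hj =>
    Function.update_of_ne (by omega) _ _
  have htop : Function.update m (n + (h + 1)) x (n + (h + 1)) = x := Function.update_self _ _ _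
  have hmemo : ∀ a : Fin n, Function.update m (n + (h + 1)) x a = m a := fun a =>
    Function.update_of_ne (by omega) _ _
  have hund' : undecided G key v (Function.update m (n + (h + 1)) x) = undecided G key v m := by
    ext a
    simp [undecided, hmemo]
  refine ⟨fun a => by rw [hmemo]; exact H.memo a, fun j hj => ?_, fun i j hij hj => ?_,
    fun _ => ?_, fun h0 => by omega, fun hb => ?_⟩
  · rw [hund']
    rcases Nat.lt_or_ge j (h + 1) with hj' | hj'
    · rw [hstack j hj']
      exact H.entry j hj'
    · obtain rfl : j = h + 1 := by omega
      exact ⟨x, htop, Relation.ReflTransGen.tail hund.1 ⟨hadj, hkey⟩, hx⟩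
  · rw [hstack i (by omega)]
    rcases Nat.lt_or_ge j (h + 1) with hj' | hj'
    · rw [hstack j hj']
      exact H.decreasing i j hij hj'
    · obtain rfl : j = h + 1 := by omega
      rw [htop]
      rcases Nat.lt_or_ge i h with hi | hi
      · exact hkey.trans (hu ▸ H.decreasing i h hi (by omega))
      · obtain rfl : i = h := by omega
        rwa [hu]
  · rw [← H.bottom (by omega)]
    exact hstack 0 (by omega)
  · have := H.budget hb
    rw [hund']
    omega

theorem SearchInv.memo_of_exit (H : SearchInv G key v b₀ m h k) (hexit : h * k = 0)
    (hb : 2 * (greedyCone G (fun u : Fin n => key u) v).ncard ≤ b₀) : m v ≠ 0 := by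
  refine H.done ?_
  rcases Nat.mul_eq_zero.1 hexit with h0 | h0
  · exact h0
  · have h1 := H.budget hb
    have h2 := H.height_le
    omega

end Search

/-! ### The program -/

/-- One step of the scan of the adjacency list of the vertex in register `8`, whose key is in
register `9`; register `10` counts down the entries. Register `11` counts the neighbours of smaller
key that are known to be in the greedy set, and register `12` holds `x + 1` for an undecided
neighbour `x` of smaller key, or `0` if there is none so far. -/
def scanStep : Program :=
  block [.op .sub 10 10 4, .nbr 13 8 10,
    .rand 14 13, .op .mod 14 14 3, .op .mul 14 14 0, .op .add 14 14 13,
    .op .lt 15 14 9, .load 16 13,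
    .op .eq 19 16 4, .op .mul 19 19 15, .op .add 11 11 19,
    .op .eq 16 16 20, .op .mul 16 16 15,
    .ite 16 (block [.op .add 12 13 4]) (block [])]

/-- One iteration of the depth-first search: the vertex on top of the stack is decided and popped,
or an undecided neighbour of smaller key is pushed. -/
def searchStep : Program :=
  block [.op .sub 17 6 4, .op .add 17 17 0, .load 8 17,
    .rand 9 8, .op .mod 9 9 3, .op .mul 9 9 0, .op .add 9 9 8,
    .deg 10 8, .const 11 0, .const 12 0,
    .while 10 scanStep,
    .ite 11 (block [.store 8 18, .op .sub 6 6 4])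
      (block [.ite 12
        (block [.op .sub 12 12 4, .op .add 17 0 6, .store 17 12, .op .add 6 6 4])
        (block [.store 8 4, .op .sub 6 6 4])]),
    .op .sub 5 5 4, .op .mul 7 6 5]

/-- The algorithm. Register `3` holds the number of levels, `4`, `18` and `20` the constants `1`,
`2` and `0`, register `5` the remaining budget and register `6` the height of the stack. The budget
is `20 * Nat.size n * l ^ l`, except that the multiplications by `l` end once it is at least `2 * n`,
which no search exceeds, so that it fits into a word. The search begins with an empty stack if the
memo table already holds the answer. -/
def misProgram : Program :=
  block [.const 4 1, .const 18 2, .const 3 64, .op .add 19 1 4, .op .mul 3 3 19,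
    .op .add 10 0 20,
    .while 10 (block [.op .div 10 10 18, .op .add 5 5 4]),
    .const 19 20, .op .mul 5 5 19, .op .mul 19 18 0, .op .add 10 3 20,
    .while 10 (block [.op .sub 10 10 4, .op .lt 7 5 19,
      .ite 7 (block [.op .mul 5 5 3]) (block [])]),
    .load 16 2, .op .eq 6 16 20, .store 0 2, .op .mul 7 6 5,
    .while 7 searchStep,
    .load 16 2, .op .eq 0 16 4]

/-! ### Verification of the program -/

section Verification

variable {n : ℕ} {G : SimpleGraph (Fin n)} {L : AdjacencyLists G} {w l d : ℕ} {ω : Tape w}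
  {v : Fin n}

/-- The order of the greedy algorithm: by level, ties broken by the name of the vertex. -/
def levelKey (n l : ℕ) (ω : Tape w) (u : ℕ) : ℕ := level ω l u * n + u

theorem injective_levelKey : Function.Injective fun u : Fin n => levelKey n l ω u := by
  intro a b hab
  have h : (levelKey n l ω a) % n = (levelKey n l ω b) % n := congrArg (· % n) hab
  simp only [levelKey, Nat.mul_add_mod_of_lt a.2, Nat.mul_add_mod_of_lt b.2] at h
  exact Fin.ext h

theorem level_le_of_levelKey_lt (a b : Fin n) (h : levelKey n l ω b < levelKey n l ω a) :
    level ω l b ≤ level ω l a := by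
  by_contra! hlt
  have : (level ω l a + 1) * n ≤ level ω l b * n := Nat.mul_le_mul_right n hlt
  rw [add_mul] at this
  have ha := a.2
  simp only [levelKey] at h
  omega

/-- All numbers that occur in the computation fit into a word. -/
structure FitsInWord (n l w : ℕ) : Prop where
  pos : 0 < l
  lt : (20 * Nat.size n + 2 * n * l + n + 70) * (n + 1) < 2 ^ w

theorem FitsInWord.lt_of_le (h : FitsInWord n l w) {a : ℕ}
    (ha : a ≤ 20 * Nat.size n + 2 * n * l + n + 70) : a < 2 ^ w :=
  lt_of_le_of_lt (ha.trans (Nat.le_mul_of_pos_right _ (Nat.succ_pos n))) h.lt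

theorem FitsInWord.mul_lt (h : FitsInWord n l w) {a b : ℕ} (hb : b ≤ n)
    (ha : a ≤ 20 * Nat.size n + 2 * n * l + n + 70) : b * a < 2 ^ w := by
  refine lt_of_le_of_lt ?_ h.lt
  rw [mul_comm]
  exact Nat.mul_le_mul ha (by omega)

theorem level_mul_add_le (hl : 0 < l) (u : ℕ) : level ω l u * n + n ≤ n * l := by
  have : level ω l u + 1 ≤ l := Nat.mod_lt _ hl
  calc level ω l u * n + n = (level ω l u + 1) * n := by ring
    _ ≤ l * n := Nat.mul_le_mul_right n this
    _ = n * l := mul_comm _ _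

/-- The registers that stay fixed during the search. -/
structure Environment (n l v : ℕ) (σ : State) : Prop where
  size : σ.reg 0 = n
  query : σ.reg 2 = v
  levels : σ.reg 3 = l
  one : σ.reg 4 = 1
  two : σ.reg 18 = 2
  zero : σ.reg 20 = 0

/-- The loop invariant of the scan of the adjacency list of `u` that started in the state `σ₀`,
with the entries `0, …, i - 1` left. -/
structure ScanInv (L : AdjacencyLists G) (key : ℕ → ℕ) (u : Fin n) (σ₀ : State) (i : ℕ)
    (σ : State) : Prop where
  mem : σ.mem = σ₀.mem
  reg : ∀ r, r < 10 ∨ r = 18 ∨ r = 20 → σ.reg r = σ₀.reg r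
  counter : σ.reg 10 = i
  counter_le : i ≤ L.degAt u
  found_le : σ.reg 11 + i ≤ L.degAt u
  found : σ.reg 11 ≠ 0 ↔ ∃ j, i ≤ j ∧ j < L.degAt u ∧ key (L.nbrAt u j) < key u ∧
    σ₀.mem (L.nbrAt u j) = 1
  pending : (σ.reg 12 = 0 ∧ ∀ j, i ≤ j → j < L.degAt u → key (L.nbrAt u j) < key u →
      σ₀.mem (L.nbrAt u j) ≠ 0) ∨
    ∃ j, j < L.degAt u ∧ key (L.nbrAt u j) < key u ∧ σ₀.mem (L.nbrAt u j) = 0 ∧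
      σ.reg 12 = L.nbrAt u j + 1

theorem runs_scanStep (hw : FitsInWord n l w) (hdeg : ∀ u, L.degAt u ≤ n) {u : Fin n}
    {σ₀ : State} (env : Environment n l v σ₀) (h8 : σ₀.reg 8 = u)
    (h9 : σ₀.reg 9 = levelKey n l ω u) {i : ℕ} {σ : State}
    (H : ScanInv L (levelKey n l ω) u σ₀ (i + 1) σ) :
    Runs L w (2 * n) ω scanStep σ 20 (ScanInv L (levelKey n l ω) u σ₀ i) := by
  obtain ⟨hmem, hreg, hcount, hcount_le, hfound_le, hfound, hpend⟩ := H
  have e0 : σ.reg 0 = n := (hreg 0 (by omega)).trans env.size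
  have e3 : σ.reg 3 = l := (hreg 3 (by omega)).trans env.levels
  have e4 : σ.reg 4 = 1 := (hreg 4 (by omega)).trans env.one
  have e20 : σ.reg 20 = 0 := (hreg 20 (by omega)).trans env.zero
  have e8 : σ.reg 8 = u := (hreg 8 (by omega)).trans h8
  have e9 : σ.reg 9 = levelKey n l ω u := (hreg 9 (by omega)).trans h9
  have hD := hdeg u
  obtain ⟨x, hx, hadj⟩ := L.exists_nbrAt_eq (u := u) (j := i) (by omega)
  have hxn := x.2
  have hlev := level_mul_add_le (n := n) (ω := ω) hw.pos x
  have hnl : n ≤ n * l := Nat.le_mul_of_pos_right _ hw.pos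
  have hll : l ≤ n * l := Nat.le_mul_of_pos_left _ (by omega)
  have hmod : level ω l x < l := Nat.mod_lt _ hw.pos
  have hmul2 : 2 * n * l = n * l + n * l := by ring
  set c := if levelKey n l ω x < levelKey n l ω u then 1 else 0 with hc
  have hc1 : c ≤ 1 := by rw [hc]; split_ifs <;> omega
  set a := (if σ₀.mem x = 1 then 1 else 0) * c with ha
  have ha1 : a ≤ 1 := by
    rw [ha]; split_ifs <;> omega
  set b := (if σ₀.mem x = 0 then 1 else 0) * c with hb
  have hb1 : b ≤ 1 := by
    rw [hb]; split_ifs <;> omega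
  have bound : ∀ {a : ℕ}, a ≤ 20 * Nat.size n + 2 * n * l + n + 70 → a < 2 ^ w := hw.lt_of_le
  -- the state before the conditional enters only through the registers listed here
  suffices hlast : ∀ σ₁ : State, σ₁.mem = σ₀.mem →
      (∀ r, r < 10 ∨ r = 18 ∨ r = 20 → σ₁.reg r = σ₀.reg r) → σ₁.reg 10 = i →
      σ₁.reg 11 = σ.reg 11 + a → σ₁.reg 12 = σ.reg 12 → σ₁.reg 13 = x → σ₁.reg 16 = b →
      Runs L w (2 * n) ω (block [.ite 16 (block [.op .add 12 13 4]) (block [])]) σ₁ 4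
        (ScanInv L (levelKey n l ω) u σ₀ i) by
    refine Runs.mono (T := 4 + 13) ?_ (by omega) fun _ h => h
    unfold scanStep
    refine Runs.op i (by simp [BinOp.eval, hcount, e4]) (bound (by omega)) ?_
    refine Runs.nbr u i (by simp [State.set_reg, e8]) (by simp [State.set_reg]) ?_
    rw [hx]
    refine Runs.rand x (by simp [State.set_reg]) ?_
    refine Runs.op (level ω l x) (by simp [BinOp.eval, State.set_reg, e3, level])
      (bound (by omega)) ?_
    refine Runs.op (level ω l x * n) (by simp [BinOp.eval, State.set_reg, e0])
      (bound (by omega)) ?_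
    refine Runs.op (levelKey n l ω x) (by simp [BinOp.eval, State.set_reg, levelKey])
      (bound (by rw [levelKey]; omega)) ?_
    refine Runs.op c (by simp [BinOp.eval, State.set_reg, e9, hc]) (bound (by omega)) ?_
    refine Runs.load x (by simp [State.set_reg]) (by omega) ?_
    refine Runs.op (if σ₀.mem x = 1 then 1 else 0)
      (by simp [BinOp.eval, State.set_reg, State.set_mem, e4, hmem])
      (bound (by split_ifs <;> omega)) ?_
    refine Runs.op a (by simp [BinOp.eval, State.set_reg, ha]) (bound (by omega)) ?_
    refine Runs.op (σ.reg 11 + a) (by simp [BinOp.eval, State.set_reg]) (bound (by omega)) ?_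
    refine Runs.op (if σ₀.mem x = 0 then 1 else 0)
      (by simp [BinOp.eval, State.set_reg, State.set_mem, e20, hmem])
      (bound (by split_ifs <;> omega)) ?_
    refine Runs.op b (by simp [BinOp.eval, State.set_reg, hb]) (bound (by omega)) ?_
    refine hlast _ hmem (fun r hr => ?_) ?_ ?_ ?_ ?_ ?_
    · have hne : r ≠ 10 ∧ r ≠ 11 ∧ r ≠ 13 ∧ r ≠ 14 ∧ r ≠ 15 ∧ r ≠ 16 ∧ r ≠ 19 := by
        clear * - hr
        omega
      simp only [State.set_reg, hne, if_false]
      exact hreg r hr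
    all_goals simp [State.set_reg]
  intro σ₁ hmem₁ hreg₁ h10 h11 h12 h13 h16
  have h4 : σ₁.reg 4 = 1 := (hreg₁ 4 (by omega)).trans env.one
  have hfound' : σ₁.reg 11 ≠ 0 ↔ ∃ j, i ≤ j ∧ j < L.degAt u ∧
      levelKey n l ω (L.nbrAt u j) < levelKey n l ω u ∧ σ₀.mem (L.nbrAt u j) = 1 := by
    have h1 : σ₁.reg 11 ≠ 0 ↔ (σ.reg 11 ≠ 0 ∨ a ≠ 0) := by rw [h11]; omega
    have h2 : a ≠ 0 ↔ levelKey n l ω x < levelKey n l ω u ∧ σ₀.mem x = 1 := by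
      rw [ha, hc]; split_ifs <;> simp_all
    rw [h1, h2, hfound]
    constructor
    · rintro (⟨j, hj, h⟩ | h)
      · exact ⟨j, by omega, h⟩
      · exact ⟨i, le_rfl, by omega, by rw [hx]; exact h⟩
    · rintro ⟨j, hj, hjd, h⟩
      rcases Nat.eq_or_lt_of_le hj with rfl | hj
      · exact Or.inr (by rwa [hx] at h)
      · exact Or.inl ⟨j, hj, hjd, h⟩
  have hb2 : b ≠ 0 ↔ levelKey n l ω x < levelKey n l ω u ∧ σ₀.mem x = 0 := by
    rw [hb, hc]; split_ifs <;> simp_all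
  have hfound_le' : σ₁.reg 11 + i ≤ L.degAt u := by omega
  refine Runs.cons (T := 2 + 1) (T' := 1) (Runs.ite (fun hne => ?_) fun heq => ?_)
  · rw [h16] at hne
    refine Runs.op (x + 1) (by simp [BinOp.eval, h13, h4]) (bound (by omega)) ?_
    refine Runs.nil (Runs.nil ⟨hmem₁, fun r hr => ?_, ?_, by omega, ?_, ?_, ?_⟩)
    · have hne : r ≠ 12 ∧ r ≠ 21 := by
        clear * - hr
        omega
      simp only [State.set_reg, hne, if_false]
      exact hreg₁ r hr
    · simpa [State.set_reg] using h10
    · simpa [State.set_reg] using hfound_le'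
    · simpa [State.set_reg] using hfound'
    · refine Or.inr ⟨i, by omega, ?_⟩
      rw [hx]
      exact ⟨(hb2.1 hne).1, (hb2.1 hne).2, by simp [State.set_reg]⟩
  · rw [h16] at heq
    refine Runs.mono (T := 1) (Runs.nil (Runs.nil
      ⟨hmem₁, fun r hr => ?_, ?_, by omega, ?_, ?_, ?_⟩)) (by omega) fun _ h => h
    · have hne : r ≠ 21 := by
        clear * - hr
        omega
      simp only [State.set_reg, hne, if_false]
      exact hreg₁ r hr
    · simpa [State.set_reg] using h10
    · simpa [State.set_reg] using hfound_le'
    · simpa [State.set_reg] using hfound'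
    · rcases hpend with ⟨h0, h⟩ | h
      · refine Or.inl ⟨by simpa [State.set_reg, h12] using h0, fun j hj hjd hk hm => ?_⟩
        rcases Nat.eq_or_lt_of_le hj with rfl | hj
        · rw [hx] at hk hm
          exact hb2.2 ⟨hk, hm⟩ heq
        · exact h j hj hjd hk hm
      · refine Or.inr ?_
        simpa [State.set_reg, h12] using h

/-- The state of the machine between two iterations of the search. -/
structure LoopInv (G : SimpleGraph (Fin n)) (key : ℕ → ℕ) (l : ℕ) (v : Fin n) (b₀ k : ℕ)
    (σ : State) : Prop where
  env : Environment n l v σ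
  budget : σ.reg 5 = k
  budget_le : k ≤ 20 * Nat.size n + 2 * n * l
  flag : σ.reg 7 = σ.reg 6 * k
  search : SearchInv G key v b₀ σ.mem (σ.reg 6) k

theorem runs_searchStep (hw : FitsInWord n l w) (hn : 2 ≤ n) (hdn : d ≤ n)
    (hdeg : ∀ u, L.degAt u ≤ d)
    {b₀ k : ℕ} {σ : State} (H : LoopInv G (levelKey n l ω) l v b₀ (k + 1) σ)
    (h7 : σ.reg 7 ≠ 0) :
    Runs L w (2 * n) ω searchStep σ (30 + 21 * d) (LoopInv G (levelKey n l ω) l v b₀ k) := by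
  obtain ⟨⟨e0, e2, e3, e4, e18, e20⟩, hbud, hbud_le, hflag, hs⟩ := H
  obtain ⟨h, hh⟩ : ∃ h, σ.reg 6 = h + 1 := Nat.exists_eq_succ_of_ne_zero fun h0 => by
    rw [hflag, h0, zero_mul] at h7
    exact h7 rfl
  rw [hh] at hs
  have hhn := hs.height_le_card
  obtain ⟨u, hu, hund⟩ := hs.entry h (by omega)
  have hun := u.2
  have hlev := level_mul_add_le (n := n) (ω := ω) hw.pos u
  have hnl : n ≤ n * l := Nat.le_mul_of_pos_right _ hw.pos
  have hll : l ≤ n * l := Nat.le_mul_of_pos_left _ (by omega)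
  have hmod : level ω l u < l := Nat.mod_lt _ hw.pos
  have hmul2 : 2 * n * l = n * l + n * l := by ring
  have bound : ∀ {a : ℕ}, a ≤ 20 * Nat.size n + 2 * n * l + n + 70 → a < 2 ^ w := hw.lt_of_le
  have hdu := hdeg u
  refine Runs.mono (T := ((L.degAt u * 21 + 1) + 15) + 10) ?_ (by omega) fun _ h => h
  unfold searchStep
  refine Runs.op h (by simp [BinOp.eval, hh, e4]) (bound (by omega)) ?_
  refine Runs.op (n + h) (by simp [BinOp.eval, State.set_reg, e0, add_comm])
    (bound (by omega)) ?_
  refine Runs.load (n + h) (by simp [State.set_reg]) (by omega) ?_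
  simp only [State.set_mem, hu]
  refine Runs.rand u (by simp [State.set_reg]) ?_
  refine Runs.op (level ω l u) (by simp [BinOp.eval, State.set_reg, e3, level])
    (bound (by omega)) ?_
  refine Runs.op (level ω l u * n) (by simp [BinOp.eval, State.set_reg, e0])
    (bound (by omega)) ?_
  refine Runs.op (levelKey n l ω u) (by simp [BinOp.eval, State.set_reg, levelKey])
    (bound (by rw [levelKey]; omega)) ?_
  refine Runs.deg u (by simp [State.set_reg]) ?_
  refine Runs.const (bound (by omega)) ?_
  refine Runs.const (bound (by omega)) ?_
  refine Runs.cons (T := L.degAt u * 21 + 1) (T' := 15) ?_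
  generalize hσ₀ : ((((((((((σ.set 17 h).set 17 (n + h)).set 8 u).set 9 (ω.read u)).set 9
    (level ω l u)).set 9 (level ω l u * n)).set 9 (levelKey n l ω u)).set 10 (L.degAt u)).set 11
      0).set 12 0) = σ₀
  have f8 : σ₀.reg 8 = u := by simp [← hσ₀, State.set_reg]
  have f9 : σ₀.reg 9 = levelKey n l ω u := by simp [← hσ₀, State.set_reg]
  have fmem : σ₀.mem = σ.mem := by simp [← hσ₀, State.set_mem]
  have freg : ∀ r, r < 8 ∨ r = 18 ∨ r = 20 → σ₀.reg r = σ.reg r := by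
    intro r hr
    have hne : r ≠ 8 ∧ r ≠ 9 ∧ r ≠ 10 ∧ r ≠ 11 ∧ r ≠ 12 ∧ r ≠ 17 := by
      clear * - hr
      omega
    simp only [← hσ₀, State.set_reg, hne, if_false]
  have env : Environment n l v σ₀ :=
    ⟨(freg 0 (by omega)).trans e0, (freg 2 (by omega)).trans e2, (freg 3 (by omega)).trans e3,
      (freg 4 (by omega)).trans e4, (freg 18 (by omega)).trans e18,
      (freg 20 (by omega)).trans e20⟩
  have hscan : ScanInv L (levelKey n l ω) u σ₀ (L.degAt u) σ₀ := by
    refine ⟨rfl, fun _ _ => rfl, by simp [← hσ₀, State.set_reg], le_rfl,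
      by simp [← hσ₀, State.set_reg], ?_, Or.inl ⟨by simp [← hσ₀, State.set_reg], ?_⟩⟩
    · refine iff_of_false (by simp [← hσ₀, State.set_reg]) ?_
      rintro ⟨j, h1, h2, _⟩
      omega
    · intro j h1 h2
      omega
  refine (Runs.while (ScanInv L (levelKey n l ω) u σ₀) (T := 20) (fun i τ hτ hne => ?_)
    (L.degAt u) hscan).mono (T' := L.degAt u * 21 + 1) le_rfl ?_
  · rw [hτ.counter] at hne
    obtain ⟨i', rfl⟩ := Nat.exists_eq_succ_of_ne_zero hne
    exact ⟨i', rfl, runs_scanStep hw (fun u => (hdeg u).trans hdn) env f8 f9 hτ⟩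
  rintro τ ⟨hzero, i, hτ⟩
  obtain ⟨hmem, hreg, hcount, hcount_le, hfound_le, hfound, hpend⟩ := hτ
  obtain rfl : i = 0 := by rw [← hcount, hzero]
  rw [fmem] at hmem hfound hpend
  have greg : ∀ r, r < 8 ∨ r = 18 ∨ r = 20 → τ.reg r = σ.reg r := fun r hr =>
    (hreg r (by omega)).trans (freg r hr)
  have g0 := (greg 0 (by omega)).trans e0
  have g2 := (greg 2 (by omega)).trans e2
  have g3 := (greg 3 (by omega)).trans e3
  have g4 := (greg 4 (by omega)).trans e4
  have g5 := (greg 5 (by omega)).trans hbud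
  have g6 := (greg 6 (by omega)).trans hh
  have g8 := (hreg 8 (by omega)).trans f8
  have g18 := (greg 18 (by omega)).trans e18
  have g20 := (greg 20 (by omega)).trans e20
  -- the last two instructions restore the invariant once the stack and the memo are updated
  have hfinish : ∀ (h' : ℕ) (m' : ℕ → ℕ) (υ : State),
      SearchInv G (levelKey n l ω) v b₀ m' h' k →
      υ.mem = m' → υ.reg 6 = h' → Environment n l v υ → υ.reg 5 = k + 1 →
      Runs L w (2 * n) ω (block [.op .sub 5 5 4, .op .mul 7 6 5]) υ (1 + 1 + 1)
        (LoopInv G (levelKey n l ω) l v b₀ k) := by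
    rintro h' m' υ hs' rfl rfl ⟨i0, i2, i3, i4, i18, i20⟩ i5
    refine Runs.op k (by simp [BinOp.eval, i5, i4]) (bound (by omega)) ?_
    refine Runs.op (υ.reg 6 * k) (by simp [BinOp.eval, State.set_reg])
      (hw.mul_lt hs'.height_le_card (by omega)) ?_
    refine Runs.nil ⟨⟨?_, ?_, ?_, ?_, ?_, ?_⟩, ?_, by omega, ?_, ?_⟩
    all_goals simp [State.set_reg, State.set_mem, *]
  refine Runs.cons (T := 11 + 1) (T' := 1 + 1 + 1) (Runs.ite (fun hne => ?_) fun heq => ?_)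
  · obtain ⟨j, -, hj, hk, hm⟩ := hfound.1 hne
    obtain ⟨x, hx, hadj⟩ := L.exists_nbrAt_eq hj
    rw [hx] at hk hm
    have hpop := hs.pop hu (c := 2) (Or.inr ⟨rfl, fun hg => ?_⟩)
    · refine Runs.mono (T := 1 + 1 + 1) ?_ (by omega) fun _ h => h
      refine Runs.store u 2 g8 g18 (by omega) ?_
      refine Runs.op h (by simp [BinOp.eval, g6, g4]) (bound (by omega)) ?_
      refine Runs.nil (hfinish h _ _ hpop ?_ ?_ ⟨?_, ?_, ?_, ?_, ?_, ?_⟩ ?_)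
      all_goals simp [State.set_reg, State.set_mem, *]
    · refine greedyMem_iff.1 hg x hadj hk ?_
      rcases hs.memo x with h' | h' | h'
      · omega
      · exact h'.2
      · omega
  · refine Runs.mono (T := (9 + 1) + 1) ?_ (by omega) fun _ h => h
    refine Runs.cons (T' := 1) (Runs.ite (fun hne' => ?_) fun heq' => ?_)
    · rcases hpend with h' | ⟨j, hj, hk, hm, h12⟩
      · exact absurd h'.1 hne'
      obtain ⟨x, hx, hadj⟩ := L.exists_nbrAt_eq hj
      rw [hx] at hk hm h12
      have hxn := x.2
      have hpush := hs.push hu hadj hk hm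
      have hle := hpush.height_le_card
      refine Runs.mono (T := 1 + 1 + 1 + 1 + 1) ?_ (by omega) fun _ h => h
      refine Runs.op x (by simp [BinOp.eval, h12, g4]) (bound (by omega)) ?_
      refine Runs.op (n + (h + 1)) (by simp [BinOp.eval, State.set_reg, g0, g6])
        (bound (by omega)) ?_
      refine Runs.store (n + (h + 1)) x (by simp [State.set_reg]) (by simp [State.set_reg])
        (by omega) ?_
      refine Runs.op (h + 2) (by simp [BinOp.eval, State.set_reg, g6, g4]) (bound (by omega)) ?_
      refine Runs.nil (Runs.nil (hfinish (h + 2) _ _ hpush ?_ ?_ ⟨?_, ?_, ?_, ?_, ?_, ?_⟩ ?_))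
      all_goals simp [State.set_reg, State.set_mem, *]
    · have hpend' : ∀ j, j < L.degAt u → levelKey n l ω (L.nbrAt u j) < levelKey n l ω u →
          σ.mem (L.nbrAt u j) ≠ 0 := by
        rcases hpend with h' | ⟨j, hj, hk, hm, h12⟩
        · exact fun j => h'.2 j (Nat.zero_le _)
        · omega
      have hpop := hs.pop hu (c := 1) (Or.inl ⟨rfl, greedyMem_iff.2 fun x hadj hk hg => ?_⟩)
      · refine Runs.mono (T := 1 + 1 + 1) ?_ (by omega) fun _ h => h
        refine Runs.store u 1 g8 g4 (by omega) ?_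
        refine Runs.op h (by simp [BinOp.eval, g6, g4]) (bound (by omega)) ?_
        refine Runs.nil (Runs.nil (hfinish h _ _ hpop ?_ ?_ ⟨?_, ?_, ?_, ?_, ?_, ?_⟩ ?_))
        all_goals simp [State.set_reg, State.set_mem, *]
      · obtain ⟨j, hj, hx⟩ := L.exists_lt_degAt hadj
        have h1 := hpend' j hj (by rwa [hx])
        have h2 : σ.mem (L.nbrAt u j) ≠ 1 := fun h1 =>
          absurd heq (hfound.2 ⟨j, Nat.zero_le _, hj, by rwa [hx], h1⟩)
        rw [hx] at h1 h2
        rcases hs.memo x with h' | h' | h'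
        · exact h1 h'
        · exact h2 h'.1
        · exact h'.2 hg

end Verification

/-! ### The analysis of a query -/

section Query

variable {n : ℕ} {G : SimpleGraph (Fin n)} {L : AdjacencyLists G} {w l d : ℕ} {ω : Tape w}
  {v : Fin n}

theorem size_div_two {a : ℕ} (ha : a ≠ 0) : Nat.size a = Nat.size (a / 2) + 1 := by
  refine le_antisymm (Nat.size_le.2 ?_) (Nat.lt_size.2 ?_)
  · have := Nat.lt_size_self (a / 2)
    rw [pow_succ]
    omega
  · rcases Nat.eq_zero_or_pos (a / 2) with h | h
    · rw [h, Nat.size_zero, pow_zero]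
      omega
    · obtain ⟨k, hk⟩ := Nat.exists_eq_succ_of_ne_zero (Nat.size_pos.2 h).ne'
      have : 2 ^ k ≤ a / 2 := Nat.lt_size.1 (by omega)
      rw [hk, Nat.succ_eq_add_one, pow_succ]
      omega

theorem runs_sizeLoop (hw : FitsInWord n l w) {σ : State} (h4 : σ.reg 4 = 1)
    (h18 : σ.reg 18 = 2) (h5 : σ.reg 5 = 0) (h10 : σ.reg 10 = n) (s : ℕ) :
    Runs L w s ω (.while 10 (block [.op .div 10 10 18, .op .add 5 5 4])) σ
      (4 * Nat.size n + 1) fun τ => τ.mem = σ.mem ∧ τ.reg 5 = Nat.size n ∧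
        ∀ r, r ≠ 5 → r ≠ 10 → r ≠ 21 → τ.reg r = σ.reg r := by
  have hinit : (σ.mem = σ.mem ∧ Nat.size (σ.reg 10) = Nat.size n ∧
      σ.reg 5 + Nat.size n = Nat.size n ∧ σ.reg 10 ≤ n ∧
      ∀ r, r ≠ 5 → r ≠ 10 → r ≠ 21 → σ.reg r = σ.reg r) :=
    ⟨rfl, by rw [h10], by omega, h10.le, fun _ _ _ _ => rfl⟩
  refine (Runs.while (fun k τ => τ.mem = σ.mem ∧ Nat.size (τ.reg 10) = k ∧
    τ.reg 5 + k = Nat.size n ∧ τ.reg 10 ≤ n ∧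
      ∀ r, r ≠ 5 → r ≠ 10 → r ≠ 21 → τ.reg r = σ.reg r) (T := 3) ?_ _ hinit).mono (by omega) ?_
  · rintro k τ ⟨hm, hk, h5', hle, hr⟩ hne
    have e4 := (hr 4 (by omega) (by omega) (by omega)).trans h4
    have e18 := (hr 18 (by omega) (by omega) (by omega)).trans h18
    have hs := size_div_two hne
    refine ⟨Nat.size (τ.reg 10 / 2), by omega, ?_⟩
    refine Runs.mono (T := 1 + 1 + 1) ?_ (by omega) fun _ h => h
    refine Runs.op (τ.reg 10 / 2) (by simp [BinOp.eval, e18]) (hw.lt_of_le (by omega)) ?_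
    refine Runs.op (τ.reg 5 + 1) (by simp [BinOp.eval, State.set_reg, e4])
      (hw.lt_of_le (by omega)) ?_
    refine Runs.nil ⟨hm, by simp [State.set_reg], ?_, ?_, fun r h1 h2 h3 => ?_⟩
    · simp only [State.set_reg]
      norm_num
      omega
    · simp only [State.set_reg]
      norm_num
      omega
    · simp only [State.set_reg, h1, h2, h3, if_false]
      exact hr r h1 h2 h3
  · rintro τ ⟨h0, k, hm, hk, h5', hle, hr⟩
    rw [h0, Nat.size_zero] at hk
    exact ⟨hm, by omega, hr⟩

theorem runs_budgetLoop (hw : FitsInWord n l w) {σ : State} {b : ℕ}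
    (h3 : σ.reg 3 = l) (h4 : σ.reg 4 = 1) (h5 : σ.reg 5 = b) (hb : b ≤ 20 * Nat.size n)
    (h19 : σ.reg 19 = 2 * n) (h10 : σ.reg 10 = l) (hn : 0 < n) (s : ℕ) :
    Runs L w s ω (.while 10 (block [.op .sub 10 10 4, .op .lt 7 5 19,
      .ite 7 (block [.op .mul 5 5 3]) (block [])])) σ (7 * l + 1) fun τ =>
        τ.mem = σ.mem ∧ τ.reg 5 ≤ b * l ^ l ∧ (2 * n ≤ τ.reg 5 ∨ τ.reg 5 = b * l ^ l) ∧
        τ.reg 5 ≤ 20 * Nat.size n + 2 * n * l ∧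
        ∀ r, r ≠ 5 → r ≠ 7 → r ≠ 10 → r ≠ 21 → τ.reg r = σ.reg r := by
  have hl := hw.pos
  have hinit : (σ.mem = σ.mem ∧ σ.reg 10 = l ∧ l ≤ l ∧ σ.reg 5 ≤ b * l ^ (l - l) ∧
      (2 * n ≤ σ.reg 5 ∨ σ.reg 5 = b * l ^ (l - l)) ∧ σ.reg 5 ≤ 20 * Nat.size n + 2 * n * l ∧
      ∀ r, r ≠ 5 → r ≠ 7 → r ≠ 10 → r ≠ 21 → σ.reg r = σ.reg r) := by
    refine ⟨rfl, h10, le_rfl, ?_, Or.inr ?_, by omega, fun _ _ _ _ _ => rfl⟩ <;> simp [h5]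
  refine (Runs.while (fun k τ => τ.mem = σ.mem ∧ τ.reg 10 = k ∧ k ≤ l ∧
    τ.reg 5 ≤ b * l ^ (l - k) ∧ (2 * n ≤ τ.reg 5 ∨ τ.reg 5 = b * l ^ (l - k)) ∧
    τ.reg 5 ≤ 20 * Nat.size n + 2 * n * l ∧
    ∀ r, r ≠ 5 → r ≠ 7 → r ≠ 10 → r ≠ 21 → τ.reg r = σ.reg r) (T := 6) ?_ _ hinit).mono
      (by omega) ?_
  · rintro k τ ⟨hm, hk, hkl, hle, hor, hle', hr⟩ hne
    rw [hk] at hne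
    obtain ⟨k, rfl⟩ := Nat.exists_eq_succ_of_ne_zero hne
    have e3 := (hr 3 (by omega) (by omega) (by omega) (by omega)).trans h3
    have e4 := (hr 4 (by omega) (by omega) (by omega) (by omega)).trans h4
    have e19 := (hr 19 (by omega) (by omega) (by omega) (by omega)).trans h19
    have hpow : b * l ^ (l - k) = b * l ^ (l - (k + 1)) * l := by
      rw [mul_assoc, ← pow_succ]
      congr 2
      omega
    have hll : l ≤ n * l := Nat.le_mul_of_pos_left _ hn
    have hmul2 : 2 * n * l = n * l + n * l := by ring
    refine ⟨k, rfl, ?_⟩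
    refine Runs.mono (T := 4 + 1 + 1) ?_ (by omega) fun _ h => h
    refine Runs.op k (by simp [BinOp.eval, hk, e4]) (hw.lt_of_le (by omega)) ?_
    refine Runs.op (if τ.reg 5 < 2 * n then 1 else 0)
      (by simp [BinOp.eval, State.set_reg, e19]) (hw.lt_of_le (by split_ifs <;> omega)) ?_
    refine Runs.cons (T := 2 + 1) (T' := 1) (Runs.ite (fun hne => ?_) fun heq => ?_)
    · have hlt : τ.reg 5 < 2 * n := by
        by_contra h
        simp [State.set_reg, h] at hne
      have hmul : τ.reg 5 * l ≤ 2 * n * l := Nat.mul_le_mul_right l hlt.le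
      refine Runs.op (τ.reg 5 * l) (by simp [BinOp.eval, State.set_reg, e3])
        (hw.lt_of_le (by omega)) ?_
      refine Runs.nil (Runs.nil ⟨hm, by simp [State.set_reg], by omega, ?_, Or.inr ?_, ?_,
        fun r h1 h2 h3 h4 => ?_⟩)
      · simp only [State.set_reg]
        norm_num
        rw [hpow]
        exact Nat.mul_le_mul_right l hle
      · simp only [State.set_reg]
        norm_num
        rw [hpow, hor.resolve_left (by omega)]
      · simp only [State.set_reg]
        norm_num
        omega
      · simp only [State.set_reg, h1, h2, h3, h4, if_false]
        exact hr r h1 h2 h3 h4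
    · have hge : 2 * n ≤ τ.reg 5 := by
        by_contra h
        simp [State.set_reg, not_le.1 h] at heq
      refine Runs.mono (T := 1) (Runs.nil (Runs.nil ⟨hm, by simp [State.set_reg], by omega, ?_,
        Or.inl (by simpa [State.set_reg] using hge), by simpa [State.set_reg] using hle',
        fun r h1 h2 h3 h4 => ?_⟩)) (by omega) fun _ h => h
      · simp only [State.set_reg]
        norm_num
        rw [hpow]
        exact hle.trans (Nat.le_mul_of_pos_right _ hl)
      · simp only [State.set_reg, h2, h3, h4, if_false]
        exact hr r h1 h2 h3 h4
  · rintro τ ⟨h0, k, hm, hk, hkl, hle, hor, hle', hr⟩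
    obtain rfl : k = 0 := by rw [← hk, h0]
    exact ⟨hm, hle, hor, hle', hr⟩

open Classical in
/-- A query is answered within the time bound whatever the random words are, the memo table stays
correct, and the answer is correct if the greedy cone of the queried vertex is small. -/
theorem runs_misProgram (hn : 2 ≤ n) (hdn : d < n) (hl : l = 64 * (d + 1))
    (hw : FitsInWord n l w) (hdeg : ∀ u, L.degAt u ≤ d) (v : Fin n) {m : ℕ → ℕ}
    (hm : MemoCorrect G (levelKey n l ω) m) :
    Runs L w (2 * n) ω misProgram ⟨initialRegisters n d v, m⟩
      (40 + 4 * Nat.size n + 7 * l + 20 * Nat.size n * l ^ l * (31 + 21 * d)) fun τ =>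
        MemoCorrect G (levelKey n l ω) τ.mem ∧
        ((greedyCone G (fun u : Fin n => levelKey n l ω u) v).ncard
            ≤ 10 * Nat.size n * l ^ l →
          τ.reg 0 = if GreedyMem G (fun u : Fin n => levelKey n l ω u) v then 1 else 0) := by
  have bound : ∀ {a : ℕ}, a ≤ 20 * Nat.size n + 2 * n * l + n + 70 → a < 2 ^ w := hw.lt_of_le
  have hvn := v.2
  have hnl : n ≤ n * l := Nat.le_mul_of_pos_right _ hw.pos
  have hll : l ≤ n * l := Nat.le_mul_of_pos_left _ (by omega)
  have hmul2 : 2 * n * l = n * l + n * l := by ring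
  generalize hB : 20 * Nat.size n * l ^ l * (31 + 21 * d) = B
  refine Runs.mono (T := (4 * Nat.size n + 1 + ((7 * l + 1 + (B + 1 + 3 + 4)) + 4)) + 6) ?_
    (by omega) fun _ h => h
  unfold misProgram
  refine Runs.const (bound (by omega)) ?_
  refine Runs.const (bound (by omega)) ?_
  refine Runs.const (bound (by omega)) ?_
  refine Runs.op (d + 1) (by simp [BinOp.eval, State.set_reg, initialRegisters])
    (bound (by omega)) ?_
  refine Runs.op l (by simp [BinOp.eval, State.set_reg, hl]) (bound (by omega)) ?_
  refine Runs.op n (by simp [BinOp.eval, State.set_reg, initialRegisters]) (bound (by omega)) ?_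
  refine Runs.cons (T := 4 * Nat.size n + 1) ?_
  refine (runs_sizeLoop hw ?_ ?_ ?_ ?_ _).mono le_rfl ?_
  iterate 4 simp [State.set_reg, initialRegisters]
  rintro σ₁ ⟨hm₁, h5, hr₁⟩
  have e0 : σ₁.reg 0 = n := (hr₁ 0 (by omega) (by omega) (by omega)).trans
    (by simp [State.set_reg, initialRegisters])
  have e2 : σ₁.reg 2 = v := (hr₁ 2 (by omega) (by omega) (by omega)).trans
    (by simp [State.set_reg, initialRegisters])
  have e3 : σ₁.reg 3 = l := (hr₁ 3 (by omega) (by omega) (by omega)).trans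
    (by simp [State.set_reg])
  have e4 : σ₁.reg 4 = 1 := (hr₁ 4 (by omega) (by omega) (by omega)).trans
    (by simp [State.set_reg])
  have e18 : σ₁.reg 18 = 2 := (hr₁ 18 (by omega) (by omega) (by omega)).trans
    (by simp [State.set_reg])
  have e20 : σ₁.reg 20 = 0 := (hr₁ 20 (by omega) (by omega) (by omega)).trans
    (by simp [State.set_reg, initialRegisters])
  replace hm₁ : σ₁.mem = m := hm₁
  clear hr₁
  refine Runs.const (bound (by omega)) ?_
  refine Runs.op (20 * Nat.size n) (by simp [BinOp.eval, State.set_reg, h5, mul_comm])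
    (bound (by omega)) ?_
  refine Runs.op (2 * n) (by simp [BinOp.eval, State.set_reg, e0, e18]) (bound (by omega)) ?_
  refine Runs.op l (by simp [BinOp.eval, State.set_reg, e3, e20]) (bound (by omega)) ?_
  refine Runs.cons (T := 7 * l + 1) ?_
  refine (runs_budgetLoop hw (b := 20 * Nat.size n) ?_ ?_ ?_ le_rfl ?_ ?_ (by omega) _).mono
    le_rfl ?_
  iterate 5 simp [State.set_reg, e3, e4]
  rintro σ₂ ⟨hm₂, hle, hor, hle', hr₂⟩
  have f0 : σ₂.reg 0 = n := (hr₂ 0 (by omega) (by omega) (by omega) (by omega)).trans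
    (by simp [State.set_reg, e0])
  have f2 : σ₂.reg 2 = v := (hr₂ 2 (by omega) (by omega) (by omega) (by omega)).trans
    (by simp [State.set_reg, e2])
  have f3 : σ₂.reg 3 = l := (hr₂ 3 (by omega) (by omega) (by omega) (by omega)).trans
    (by simp [State.set_reg, e3])
  have f4 : σ₂.reg 4 = 1 := (hr₂ 4 (by omega) (by omega) (by omega) (by omega)).trans
    (by simp [State.set_reg, e4])
  have f18 : σ₂.reg 18 = 2 := (hr₂ 18 (by omega) (by omega) (by omega) (by omega)).trans
    (by simp [State.set_reg, e18])
  have f20 : σ₂.reg 20 = 0 := (hr₂ 20 (by omega) (by omega) (by omega) (by omega)).trans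
    (by simp [State.set_reg, e20])
  replace hm₂ : σ₂.mem = m := hm₂.trans hm₁
  clear hr₂
  generalize hb₀ : σ₂.reg 5 = b₀ at *
  have hstart := hm.start v b₀
  refine Runs.load v f2 (by omega) ?_
  refine Runs.op (if m v = 0 then 1 else 0)
    (by simp [BinOp.eval, State.set_reg, f20, hm₂])
    (bound (by split_ifs <;> omega)) ?_
  refine Runs.store n v (by simp [State.set_reg, f0]) (by simp [State.set_reg, f2])
    (by omega) ?_
  refine Runs.op ((if m v = 0 then 1 else 0) * b₀) (by simp [BinOp.eval, State.set_reg, hb₀])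
    (hw.mul_lt hstart.height_le_card (by omega)) ?_
  refine Runs.cons (T := B + 1) (T' := 3) ?_
  refine (Runs.while (LoopInv G (levelKey n l ω) l v b₀) (T := 30 + 21 * d)
    (fun k τ hτ hne => ?_) b₀ ⟨⟨?_, ?_, ?_, ?_, ?_, ?_⟩, ?_, ?_, ?_, ?_⟩).mono ?_ ?_
  · have hk : k ≠ 0 := by
      rintro rfl
      exact hne (by rw [hτ.flag, mul_zero])
    obtain ⟨k, rfl⟩ := Nat.exists_eq_succ_of_ne_zero hk
    exact ⟨k, rfl, runs_searchStep hw hn hdn.le hdeg hτ hne⟩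
  iterate 7 simp [State.set_reg, *]
  · exact hle'
  · simp [State.set_reg]
  · simpa [State.set_reg, State.set_mem, hm₂] using hstart
  · rw [← hB]
    refine Nat.add_le_add_right ?_ 1
    calc b₀ * (30 + 21 * d + 1) = b₀ * (31 + 21 * d) := by ring
      _ ≤ _ := Nat.mul_le_mul_right _ hle
  rintro τ ⟨hexit, k, ⟨⟨i0, i2, i3, i4, i18, i20⟩, -, -, hflag, hs⟩⟩
  rw [hflag] at hexit
  refine Runs.load v i2 (by omega) ?_
  refine Runs.op (if τ.mem v = 1 then 1 else 0) (by simp [BinOp.eval, State.set_reg, i4])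
    (bound (by split_ifs <;> omega)) ?_
  refine Runs.nil ⟨hs.memo, fun hcone => ?_⟩
  have hcard : (greedyCone G (fun u : Fin n => levelKey n l ω u) v).ncard ≤ n := by
    simpa using Set.ncard_le_ncard (Set.subset_univ
      (greedyCone G (fun u : Fin n => levelKey n l ω u) v)) Set.finite_univ
  have hbig : 2 * (greedyCone G (fun u : Fin n => levelKey n l ω u) v).ncard ≤ b₀ := by
    rcases hor with h | h
    · omega
    · rw [h, show 20 * Nat.size n * l ^ l = 2 * (10 * Nat.size n * l ^ l) by ring]
      omega
  have hv := hs.memo_of_exit hexit hbig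
  have hans : (τ.mem v = 1) ↔ GreedyMem G (fun u : Fin n => levelKey n l ω u) v := by
    rcases hs.memo v with h | h | h
    · exact absurd h hv
    · exact iff_of_true h.1 h.2
    · exact iff_of_false (by omega) h.2
  simp [State.set_reg, hans]

end Query

/-! ### Sequences of queries -/

section Answers

variable {n : ℕ} {G : SimpleGraph (Fin n)} {L : AdjacencyLists G} {A : Algorithm} {d s T : ℕ}
  {t : ℝ} {ω : Tape (A.wordLength n)} {Inv : (ℕ → ℕ) → Prop}

theorem exists_answers (ht : (T : ℝ) ≤ t)
    (h : ∀ (v : Fin n) m, Inv m → Runs L (A.wordLength n) s ω A.program ⟨initialRegisters n d v, m⟩ T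
      fun τ => Inv τ.mem) (qs : List (Fin n)) {m : ℕ → ℕ} (hm : Inv m) :
    ∃ as, Answers A d L t s ω m qs as := by
  induction qs generalizing m with
  | nil => exact ⟨[], trivial⟩
  | cons v qs ih =>
    obtain ⟨k, hk, τ, hτ, hinv⟩ := h v m hm
    obtain ⟨as, has⟩ := ih hinv
    exact ⟨τ.reg 0 :: as, k, τ, (Nat.cast_le.2 hk).trans ht, hτ, rfl, has⟩

theorem answers_map (ht : (T : ℝ) ≤ t) {y : Fin n → ℕ}
    (h : ∀ (v : Fin n) m, Inv m → Runs L (A.wordLength n) s ω A.program ⟨initialRegisters n d v, m⟩ T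
      fun τ => Inv τ.mem ∧ τ.reg 0 = y v) (qs : List (Fin n)) {m : ℕ → ℕ} (hm : Inv m) :
    Answers A d L t s ω m qs (qs.map y) := by
  induction qs generalizing m with
  | nil => trivial
  | cons v qs ih =>
    obtain ⟨k, hk, τ, hτ, hinv, hans⟩ := h v m hm
    exact ⟨k, τ, (Nat.cast_le.2 hk).trans ht, hτ, hans, ih hinv⟩

end Answers

/-! ### Bounds on the word length and the running time -/

section Bounds

theorem fitsInWord {n d l : ℕ} (hn : 2 ≤ n) (hdn : d < n) (hl : l = 64 * (d + 1)) :
    FitsInWord n l (16 * Nat.size n) := by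
  refine ⟨by omega, ?_⟩
  generalize hs : Nat.size n = s
  have h1 : n + 1 ≤ 2 ^ s := hs ▸ Nat.lt_size_self n
  have h2 : s < 2 ^ s := Nat.lt_two_pow_self
  have h3 : 2 ^ 2 ≤ 2 ^ s := Nat.pow_le_pow_right (by norm_num) (hs ▸ Nat.lt_size.2 hn)
  rw [mul_comm 16 s, pow_mul]
  generalize 2 ^ s = N at *
  have hlN : l ≤ 64 * N := by omega
  have hnl : n * l ≤ N * (64 * N) := Nat.mul_le_mul (by omega) hlN
  have hNN : N ≤ N * N := Nat.le_mul_self N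
  have h4 : 20 * s + 2 * n * l + n + 70 < 256 * (N * N) := by nlinarith
  calc (20 * s + 2 * n * l + n + 70) * (n + 1) < 256 * (N * N) * (n + 1) :=
        Nat.mul_lt_mul_of_pos_right h4 (by omega)
    _ ≤ N ^ 4 * (N * N) * N := by
        gcongr
        calc 256 = 4 ^ 4 := by norm_num
          _ ≤ N ^ 4 := Nat.pow_le_pow_left (by omega) 4
    _ = N ^ 7 := by ring
    _ ≤ N ^ 16 := Nat.pow_le_pow_right (by omega) (by norm_num)

theorem size_le_two_mul_logb {n : ℕ} (hn : 2 ≤ n) : (Nat.size n : ℝ) ≤ 2 * Real.logb 2 n := by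
  have h2 : 2 ≤ Nat.size n := Nat.lt_size.2 hn
  have h1 : 2 ^ (Nat.size n - 1) ≤ n := Nat.lt_size.1 (by omega)
  have h3 : ((Nat.size n - 1 : ℕ) : ℝ) ≤ Real.logb 2 n := by
    rw [Real.le_logb_iff_rpow_le (by norm_num) (by positivity), Real.rpow_natCast]
    exact_mod_cast h1
  rw [Nat.cast_sub (by omega), Nat.cast_one] at h3
  have h2' : (2 : ℝ) ≤ Nat.size n := by exact_mod_cast h2
  linarith

theorem pow_le_rpow_logb (d : ℕ) :
    ((64 * (d + 1) : ℕ) : ℝ) ^ (64 * (d + 1) + 1)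
      ≤ 128 ^ 129 * (d : ℝ) ^ ((800 : ℝ) * (d * Real.logb 2 d)) := by
  rcases Nat.lt_or_ge d 2 with hd | hd
  · have h1 : (d : ℝ) ^ ((800 : ℝ) * (d * Real.logb 2 d)) = 1 := by
      interval_cases d <;> simp
    rw [h1, mul_one]
    calc ((64 * (d + 1) : ℕ) : ℝ) ^ (64 * (d + 1) + 1) ≤ 128 ^ (64 * (d + 1) + 1) := by
          gcongr
          exact_mod_cast (by omega : 64 * (d + 1) ≤ 128)
      _ ≤ 128 ^ 129 := pow_le_pow_right₀ (by norm_num) (by omega)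
  · have hd1 : (1 : ℝ) ≤ d := by exact_mod_cast (by omega : 1 ≤ d)
    have hbase : 64 * (d + 1) ≤ d ^ 8 := by
      calc 64 * (d + 1) ≤ 2 ^ 7 * d := by omega
        _ ≤ d ^ 7 * d := Nat.mul_le_mul_right _ (Nat.pow_le_pow_left hd 7)
        _ = d ^ 8 := by ring
    have hlog : (1 : ℝ) ≤ Real.logb 2 d := by
      rw [Real.le_logb_iff_rpow_le (by norm_num) (by positivity), Real.rpow_one]
      exact_mod_cast hd
    calc ((64 * (d + 1) : ℕ) : ℝ) ^ (64 * (d + 1) + 1) ≤ ((d : ℝ) ^ 8) ^ (64 * (d + 1) + 1) := by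
          gcongr
          exact_mod_cast hbase
      _ = (d : ℝ) ^ (8 * (64 * (d + 1) + 1)) := by rw [← pow_mul]
      _ ≤ (d : ℝ) ^ (800 * d) := pow_le_pow_right₀ hd1 (by omega)
      _ = (d : ℝ) ^ ((800 : ℝ) * d) := by
          rw [← Real.rpow_natCast]
          push_cast
          rfl
      _ ≤ (d : ℝ) ^ ((800 : ℝ) * (d * Real.logb 2 d)) := by
          refine Real.rpow_le_rpow_of_exponent_le hd1 ?_
          have : (d : ℝ) ≤ d * Real.logb 2 d := le_mul_of_one_le_right (by positivity) hlog
          linarith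
      _ ≤ _ := le_mul_of_one_le_left (by positivity) (one_le_pow₀ (by norm_num))

theorem time_le {n d l : ℕ} (hn : 2 ≤ n) (hl : l = 64 * (d + 1)) :
    ((40 + 4 * Nat.size n + 7 * l + 20 * Nat.size n * l ^ l * (31 + 21 * d) : ℕ) : ℝ)
      ≤ (1400 * 128 ^ 129 : ℕ) * (d : ℝ) ^ (((800 : ℕ) : ℝ) * (d * Real.logb 2 d))
        * Real.logb 2 n := by
  have hs : 1 ≤ Nat.size n := Nat.size_pos.2 (by omega)
  have hnat : 40 + 4 * Nat.size n + 7 * l + 20 * Nat.size n * l ^ l * (31 + 21 * d)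
      ≤ 700 * (Nat.size n * l ^ (l + 1)) := by
    have hX : 1 ≤ l ^ l := Nat.one_le_pow _ _ (by omega)
    have h1 : 1 ≤ Nat.size n * l ^ l := Nat.mul_pos hs hX
    have h2 : Nat.size n * l ^ (l + 1) = Nat.size n * l ^ l * l := by rw [pow_succ, mul_assoc]
    have h3 : Nat.size n ≤ Nat.size n * l ^ l := Nat.le_mul_of_pos_right _ hX
    have h4 : 20 * Nat.size n * l ^ l * (31 + 21 * d)
        = 20 * (Nat.size n * l ^ l * (31 + 21 * d)) := by ring
    rw [h2, h4]
    generalize Nat.size n * l ^ l = Y at *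
    have h5 : Y * (31 + 21 * d) ≤ Y * l := Nat.mul_le_mul_left _ (by omega)
    have h6 : l ≤ Y * l := Nat.le_mul_of_pos_left _ h1
    have h7 : Y ≤ Y * l := Nat.le_mul_of_pos_right _ (by omega)
    omega
  have hpow := pow_le_rpow_logb d
  rw [← hl] at hpow
  have hlog := size_le_two_mul_logb hn
  calc ((40 + 4 * Nat.size n + 7 * l + 20 * Nat.size n * l ^ l * (31 + 21 * d) : ℕ) : ℝ)
      ≤ ((700 * (Nat.size n * l ^ (l + 1)) : ℕ) : ℝ) := by exact_mod_cast hnat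
    _ = 700 * (Nat.size n * (l : ℝ) ^ (l + 1)) := by push_cast; ring
    _ ≤ 700 * (2 * Real.logb 2 n *
          (128 ^ 129 * (d : ℝ) ^ ((800 : ℝ) * (d * Real.logb 2 d)))) := by
        gcongr
        exact (Nat.cast_nonneg _).trans hlog
    _ = _ := by
        push_cast
        ring

end Bounds

theorem indicator_mem_misSolutions {n : ℕ} {G : SimpleGraph (Fin n)} {key : Fin n → ℕ}
    (hkey : Function.Injective key) {y : Fin n → ℕ}
    (h1 : ∀ v, GreedyMem G key v → y v = 1) (h0 : ∀ v, ¬ GreedyMem G key v → y v = 0) :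
    y ∈ misSolutions G :=
  ⟨_, maximal_greedyMem hkey, fun v => ⟨h1 v, h0 v⟩⟩

end LCA

theorem theorem4p1 :
    ∃ (A : LCA.Algorithm) (c₁ c₂ c₃ : ℕ),
      ∀ (n : ℕ), 2 ≤ n → ∀ (G : SimpleGraph (Fin n)) [DecidableRel G.Adj] (d : ℕ),
        G.maxDegree = d → ∀ L : LCA.AdjacencyLists G,
          -- a local computation algorithm for maximal independent sets
          LCA.IsLocalComputationAlgorithm A d L (LCA.misSolutions G)
            (c₁ * (d : ℝ) ^ (c₂ * (d * Real.logb 2 d)) * Real.logb 2 n) (c₃ * n) (1 / n) ∧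
          -- one maximal independent set, fixed by the random tape, accounts for all query sequences
          1 - 1 / (n : ℝ) ≤ LCA.prob {ω : LCA.Tape (A.wordLength n) |
            ∃ y ∈ LCA.misSolutions G, ∀ qs : List (Fin n),
              LCA.Answers A d L
                (c₁ * (d : ℝ) ^ (c₂ * (d * Real.logb 2 d)) * Real.logb 2 n) (c₃ * n) ω 0
                qs (qs.map y)} := by
  classical
  refine ⟨⟨LCA.misProgram, 15⟩, 1400 * 128 ^ 129, 800, 2, fun n hn G _ d hd L => ?_⟩
  obtain ⟨l, hl⟩ : ∃ l, l = 64 * (d + 1) := ⟨_, rfl⟩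
  have hdn : d < n := by
    have : Nonempty (Fin n) := ⟨⟨0, by omega⟩⟩
    simpa [← hd] using G.maxDegree_lt_card_verts
  have hw : LCA.FitsInWord n l (16 * Nat.size n) := LCA.fitsInWord hn hdn hl
  have hdeg : ∀ u, L.degAt u ≤ d := fun u => hd ▸ L.degAt_le u
  have ht := LCA.time_le hn hl
  have hquery := fun (ω : LCA.Tape (16 * Nat.size n)) (v : Fin n) (m : ℕ → ℕ)
    (hm : LCA.MemoCorrect G (LCA.levelKey n l ω) m) =>
      LCA.runs_misProgram hn hdn hl hw hdeg v hm
  have hzero : ∀ ω : LCA.Tape (16 * Nat.size n), LCA.MemoCorrect G (LCA.levelKey n l ω) 0 :=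
    fun ω u => Or.inl rfl
  have hmain : 1 - 1 / (n : ℝ) ≤ LCA.prob {ω : LCA.Tape (16 * Nat.size n) |
      ∃ y ∈ LCA.misSolutions G, ∀ qs : List (Fin n),
        LCA.Answers ⟨LCA.misProgram, 15⟩ d L ((1400 * 128 ^ 129 : ℕ) *
          (d : ℝ) ^ (((800 : ℕ) : ℝ) * (d * Real.logb 2 d)) * Real.logb 2 n) (2 * n) ω 0
          qs (qs.map y)} := by
    refine (LCA.prob_forall_noDenseCluster (G := G) (l := l) hn (hd ▸ hl)
      (hw.lt_of_le (by omega)).le (hw.lt_of_le ?_).le).trans (LCA.prob_mono fun ω hω => ?_)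
    · have : l ≤ n * l := Nat.le_mul_of_pos_left _ (by omega)
      have h2 : 2 * n * l = n * l + n * l := by ring
      omega
    · refine ⟨fun v => if LCA.GreedyMem G (fun u : Fin n => LCA.levelKey n l ω u) v then 1 else 0,
        LCA.indicator_mem_misSolutions LCA.injective_levelKey (fun v hv => if_pos hv)
          (fun v hv => if_neg hv), fun qs => ?_⟩
      refine LCA.answers_map (Inv := LCA.MemoCorrect G (LCA.levelKey n l ω)) ht
        (fun v m hm => (hquery ω v m hm).mono le_rfl fun τ hτ => ⟨hτ.1, hτ.2 ?_⟩) qs (hzero ω)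
      exact LCA.ncard_greedyCone_le (lev := fun u : Fin n => LCA.level ω l u)
        (Nat.mul_pos (by norm_num) (Nat.size_pos.2 (by omega)))
        (fun u => Nat.mod_lt _ hw.pos) (hω v) LCA.level_le_of_levelKey_lt
  refine ⟨⟨fun ω qs => ?_, fun qs => ?_⟩, hmain⟩
  · exact LCA.exists_answers (Inv := LCA.MemoCorrect G (LCA.levelKey n l ω)) ht
      (fun v m hm => (hquery ω v m hm).mono le_rfl fun τ hτ => hτ.1) qs (hzero ω)
  · refine hmain.trans (LCA.prob_mono ?_)
    rintro ω ⟨y, hy, h⟩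
    exact ⟨y, hy, h qs⟩
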